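/- **Formulas and cirquents.** Fix an infinite set of atoms. Formulas are built from literals $P$, $\neg P$ ($P$ an atom) by $\wedge,\vee$; the negation $\neg F$ of an arbitrary formula abbreviates its negation normal form (double negations removed, De Morgan laws). A *cirquent* is a pair $C=(\langle\Gamma_1,\dots,\Gamma_m\rangle,\langle F_1,\dots,F_k\rangle)$ with $m,k\ge 0$, where the $F_i$ are formulas (the *pool*; its entries, counted as occurrences, are the *oformulas*) and the $\Gamma_j$ are subsets of $\{1,\dots,k\}$ (the *groups*; their occurrences in the sequence are the *ogroups*). A formula $F$ is identified with the cirquent $(\langle\{1\}\rangle,\langle F\rangle)$. **The system CL5.** A cirquent is provable in CL5 if it has a proof tree using the following rules. * *Axioms:* the empty cirquent $(\langle\rangle,\langle\rangle)$, and $(\langle\{1,2\}\rangle,\langle\neg F,F\rangle)$ for every formula $F$. * *Mix:* from two cirquents, infer the cirquent obtained by placing them side by side. * *Exchange:* swap two adjacent oformulas (redirecting membership in groups correspondingly), or swap two adjacent ogroups. * *Weakening:* add an oformula of the pool to an ogroup, or insert anywhere in the pool a new oformula that belongs to no group. * *Duplication:* replace an ogroup by two adjacent copies of it, or conversely replace two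 adjacent ogroups that are equal as sets by one. * *$\vee$-introduction:* replace two adjacent oformulas $F,G$ by the single oformula $F\vee G$, which belongs to exactly those ogroups that contained $F$ or $G$. * *$\wedge$-introduction:* applicable to adjacent oformulas $F,G$ if no ogroup contains both, every ogroup containing $F$ is immediately followed by one containing $G$, and every ogroup containing $G$ is immediately preceded by one containing $F$. Replace each ogroup containing $F$ and the one immediately following it by their union, and then replace $F,G$ by the single oformula $F\wedge G$, which belongs to exactly those ogroups that contained $F$ or $G$. **Resources.** A *port* is an output $P$ or an input $-P$, where the atom $P$ is its *type*. An *interface* is a finite sequence of ports $\langle X_1,\dots,X_n\rangle$; its entries, counted as occurrences, are called *oports* (*oinputs* and *ooutputs*). A *situation* $s$ for it assigns to each oport $X_i$ a value $s(X_i)\in\{0,1\}$. Write $s\le s'$ if $s(X_i)\le s'(X_i)$ for every output $X_i$ and $s'(X_i)\le s(X_i)$ for every input $X_i$. A *resource* $\alpha$ consists of an interface and a function from its situations to $\{0,1\}$ that is monotone with respect to $\le$; $\alpha$ is *true* in $s$ if this function has value $1$ at $s$. The resource $C^{\clubsuit}$ *represented by* a cirquent $C$ has as its interface the sequence of the occurrences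 of literals in the pool of $C$, in order of appearance, with $P$ read as the output $P$ and $\neg P$ as the input $-P$. A situation is thus an assignment of truth values to the occurrences of atoms in $C$. In such a situation, the truth values of the oformulas are computed classically from the values of their own occurrences of atoms; a group is true if at least one of its oformulas is true; and $C^{\clubsuit}$ is true if all groups of $C$ are true. The resource $F^{\clubsuit}$ represented by a formula $F$ has the same kind of interface, formed from the occurrences of literals in $F$, and it is true in a situation iff $F$ is. **Triviality.** An *allocation* for a resource $\alpha$ is a pair $(X,Y)$ consisting of an oinput $X$ and an ooutput $Y$ of $\alpha$ of the same type; it *utilizes* $X$ and $Y$. An *arrangement* for $\alpha$ is a set $\mathcal A$ of allocations for $\alpha$. It is *monogamous* if no oport is utilized by more than one allocation in $\mathcal A$. A situation $s$ is *consistent* with $\mathcal A$ if $s(X)\le s(Y)$ for all $(X,Y)\in\mathcal A$. The arrangement $\mathcal A$ is *trivializing* if $\alpha$ is true in every situation consistent with $\mathcal A$. The resource $\alpha$ is *trivial* if there is a monogamous trivializing arrangement for it, and a cirquent or formula is trivial if the resource it represents is. **Theorem (soundness and completeness of CL5 for abstract resource semantics).** A cirquent $C$ is provable in CL5 if and only if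 it is trivial. Likewise, a formula $F$, understood as the cirquent $(\langle\{1\}\rangle,\langle F\rangle)$, is provable in CL5 if and only if $F$ is trivial. -/

import Mathlib

namespace CirquentCalculus

universe u

/-- Formulas of classical propositional logic in negation normal form: negation is officially
applied only to atoms, and there are no logical atoms. -/
inductive Formula (Atom : Type u) : Type u
  | atom : Atom → Formula Atom
  | negAtom : Atom → Formula Atom
  | conj : Formula Atom → Formula Atom → Formula Atom
  | disj : Formula Atom → Formula Atom → Formula Atom

/-- Negation `¬F` of an arbitrary formula, an abbreviation via double negation and De Morgan. -/
def Formula.not {Atom : Type u} : Formula Atom → Formula Atom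
  | .atom P => .negAtom P
  | .negAtom P => .atom P
  | .conj F G => .disj F.not G.not
  | .disj F G => .conj F.not G.not

/-- A cirquent: a pool (a finite sequence of formulas) and a structure (a finite sequence of
groups). A group is a set of positions in the pool; positions are counted from `0`. -/
structure Cirquent (Atom : Type u) : Type u where
  pool : List (Formula Atom)
  str : List (Finset ℕ)
  lt_of_mem : ∀ Γ ∈ str, ∀ i ∈ Γ, i < pool.length

namespace Cirquent

variable {Atom : Type u}

/-- The singleton cirquent `(⟨{1}⟩, ⟨F⟩)`, with which the formula `F` is identified. -/
def singleton (F : Formula Atom) : Cirquent Atom where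
  pool := [F]
  str := [{0}]
  lt_of_mem := by simp

/-- The empty cirquent `(⟨⟩, ⟨⟩)`: conclusion of the empty cirquent axiom. -/
def empty : Cirquent Atom where
  pool := []
  str := []
  lt_of_mem := by simp

/-- The cirquent `(⟨{1,2}⟩, ⟨¬F, F⟩)`: conclusion of the identity axiom. -/
def identity (F : Formula Atom) : Cirquent Atom where
  pool := [F.not, F]
  str := [{0, 1}]
  lt_of_mem := by simp

/-- Mix: `E` is obtained by putting `C` and `D` next to each other. -/
def Mix (C D E : Cirquent Atom) : Prop :=
  E.pool = C.pool ++ D.pool ∧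
  E.str = C.str ++ D.str.map (fun Γ => Γ.image (fun i => C.pool.length + i))

/-- Oformula exchange: `D` results from swapping two adjacent oformulas of `C` and redirecting
all arcs correspondingly. -/
def OformulaExchange (C D : Cirquent Atom) : Prop :=
  ∃ (L₁ L₂ : List (Formula Atom)) (F G : Formula Atom),
    C.pool = L₁ ++ F :: G :: L₂ ∧
    D.pool = L₁ ++ G :: F :: L₂ ∧
    D.str = C.str.map (fun Γ => Γ.image (Equiv.swap L₁.length (L₁.length + 1)))

/-- Ogroup exchange: `D` results from swapping two adjacent ogroups of `C`. -/
def OgroupExchange (C D : Cirquent Atom) : Prop :=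
  ∃ (S₁ S₂ : List (Finset ℕ)) (Γ Δ : Finset ℕ),
    C.str = S₁ ++ Γ :: Δ :: S₂ ∧
    D.str = S₁ ++ Δ :: Γ :: S₂ ∧
    D.pool = C.pool

/-- Ogroup weakening: `D` results from inserting a new arc between an ogroup and an oformula
of `C`. -/
def OgroupWeakening (C D : Cirquent Atom) : Prop :=
  ∃ (S₁ S₂ : List (Finset ℕ)) (Γ : Finset ℕ) (i : ℕ),
    i < C.pool.length ∧ i ∉ Γ ∧
    C.str = S₁ ++ Γ :: S₂ ∧
    D.str = S₁ ++ insert i Γ :: S₂ ∧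
    D.pool = C.pool

/-- Pool weakening: `D` results from inserting a new oformula anywhere in the pool of `C`. The
new oformula is in no group; the arcs to the oformulas on its right are renumbered. -/
def PoolWeakening (C D : Cirquent Atom) : Prop :=
  ∃ (L₁ L₂ : List (Formula Atom)) (F : Formula Atom),
    C.pool = L₁ ++ L₂ ∧
    D.pool = L₁ ++ F :: L₂ ∧
    D.str = C.str.map (fun Γ => Γ.image (fun i => if i < L₁.length then i else i + 1))

/-- Downward duplication: `D` results from replacing some ogroup of `C` by two adjacent copies
of it. Upward duplication is the converse relation. -/
def Duplication (C D : Cirquent Atom) : Prop :=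
  ∃ (S₁ S₂ : List (Finset ℕ)) (Γ : Finset ℕ),
    C.str = S₁ ++ Γ :: S₂ ∧
    D.str = S₁ ++ Γ :: Γ :: S₂ ∧
    D.pool = C.pool

/-- The effect on a group of merging the adjacent oformulas number `n` and `n + 1` into a single
oformula number `n`: arcs to either of the two are redirected to the merged one, and the later
oformulas are renumbered. -/
def mergePositions (n : ℕ) (Γ : Finset ℕ) : Finset ℕ :=
  Γ.image (fun i => if i ≤ n then i else i - 1)

/-- `∨`-introduction: two adjacent oformulas `F`, `G` are merged into `F ∨ G`. -/
def DisjIntro (C D : Cirquent Atom) : Prop :=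
  ∃ (L₁ L₂ : List (Formula Atom)) (F G : Formula Atom),
    C.pool = L₁ ++ F :: G :: L₂ ∧
    D.pool = L₁ ++ .disj F G :: L₂ ∧
    D.str = C.str.map (mergePositions L₁.length)

/-- Merge each ogroup containing the oformula number `n` with the immediately following ogroup. -/
def mergeGroups (n : ℕ) : List (Finset ℕ) → List (Finset ℕ)
  | [] => []
  | [Γ] => [Γ]
  | Γ :: Δ :: S => if n ∈ Γ then (Γ ∪ Δ) :: mergeGroups n S else Γ :: mergeGroups n (Δ :: S)

/-- `∧`-introduction, for adjacent oformulas `F`, `G` (numbers `n` and `n + 1`, where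
`n = L₁.length`) such that no ogroup contains both, every ogroup containing `F` is immediately
followed by an ogroup containing `G`, and every ogroup containing `G` is immediately preceded by
an ogroup containing `F`. Each ogroup containing `F` is merged with the ogroup that follows it,
and then `F`, `G` are merged into `F ∧ G`. -/
def ConjIntro (C D : Cirquent Atom) : Prop :=
  ∃ (L₁ L₂ : List (Formula Atom)) (F G : Formula Atom),
    C.pool = L₁ ++ F :: G :: L₂ ∧
    (∀ Γ ∈ C.str, ¬ (L₁.length ∈ Γ ∧ L₁.length + 1 ∈ Γ)) ∧
    (∀ (j : ℕ) (Γ : Finset ℕ), C.str[j]? = some Γ → L₁.length ∈ Γ →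
      ∃ Δ : Finset ℕ, C.str[j + 1]? = some Δ ∧ L₁.length + 1 ∈ Δ) ∧
    (∀ (j : ℕ) (Δ : Finset ℕ), C.str[j]? = some Δ → L₁.length + 1 ∈ Δ →
      ∃ (k : ℕ) (Γ : Finset ℕ), k + 1 = j ∧ C.str[k]? = some Γ ∧ L₁.length ∈ Γ) ∧
    D.pool = L₁ ++ .conj F G :: L₂ ∧
    D.str = (mergeGroups L₁.length C.str).map (mergePositions L₁.length)

end Cirquent

/-- Provability in `CL5`: existence of a tree of cirquents in which every node follows from its
children by one of the rules axioms, mix, exchange, weakening, duplication, `∨`-introduction and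
`∧`-introduction (all core rules but contraction). -/
inductive CL5 {Atom : Type u} : Cirquent Atom → Prop
  | empty : CL5 Cirquent.empty
  | identity (F : Formula Atom) : CL5 (Cirquent.identity F)
  | mix {C D E : Cirquent Atom} : C.Mix D E → CL5 C → CL5 D → CL5 E
  | oformulaExchange {C D : Cirquent Atom} : C.OformulaExchange D → CL5 C → CL5 D
  | ogroupExchange {C D : Cirquent Atom} : C.OgroupExchange D → CL5 C → CL5 D
  | ogroupWeakening {C D : Cirquent Atom} : C.OgroupWeakening D → CL5 C → CL5 D
  | poolWeakening {C D : Cirquent Atom} : C.PoolWeakening D → CL5 C → CL5 D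
  | downwardDuplication {C D : Cirquent Atom} : C.Duplication D → CL5 C → CL5 D
  | upwardDuplication {C D : Cirquent Atom} : D.Duplication C → CL5 C → CL5 D
  | disjIntro {C D : Cirquent Atom} : C.DisjIntro D → CL5 C → CL5 D
  | conjIntro {C D : Cirquent Atom} : C.ConjIntro D → CL5 C → CL5 D

/-- A port: an output `P` or an input `-P`, where the atom `P` is the type of the port. -/
inductive Port (Atom : Type u) : Type u
  | output : Atom → Port Atom
  | input : Atom → Port Atom

/-- An interface: a finite sequence of ports. -/
structure Interface (Atom : Type u) : Type u where
  size : ℕ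
  port : Fin size → Port Atom

namespace Interface

variable {Atom : Type u}

/-- The empty interface. -/
def nil : Interface Atom := ⟨0, Fin.elim0⟩

/-- Concatenation of interfaces. -/
def append (I J : Interface Atom) : Interface Atom := ⟨I.size + J.size, Fin.append I.port J.port⟩

/-- A situation for an interface: an assignment of truth values to its oports. -/
abbrev Situation (I : Interface Atom) : Type := Fin I.size → Bool

/-- The initial part of a situation for a concatenation. -/
def Situation.left {I J : Interface Atom} (s : (I.append J).Situation) : I.Situation :=
  fun i => s (Fin.castAdd J.size i)

/-- The final part of a situation for a concatenation. -/
def Situation.right {I J : Interface Atom} (s : (I.append J).Situation) : J.Situation :=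
  fun i => s (Fin.natAdd I.size i)

/-- The order on situations: increasing on outputs and decreasing on inputs. -/
def SituationLE (I : Interface Atom) (s t : I.Situation) : Prop :=
  ∀ i : Fin I.size,
    ((∃ P, I.port i = .output P) → s i ≤ t i) ∧ ((∃ P, I.port i = .input P) → t i ≤ s i)

theorem SituationLE.left {I J : Interface Atom} {s t : (I.append J).Situation}
    (h : (I.append J).SituationLE s t) : I.SituationLE s.left t.left := by
  intro i
  have := h (Fin.castAdd J.size i)
  simpa [append, Situation.left] using this

theorem SituationLE.right {I J : Interface Atom} {s t : (I.append J).Situation}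
    (h : (I.append J).SituationLE s t) : J.SituationLE s.right t.right := by
  intro i
  have := h (Fin.natAdd I.size i)
  simpa [append, Situation.right] using this

end Interface

/-- An abstract resource: an interface with a monotone truth function on its situations. -/
structure Resource (Atom : Type u) : Type u where
  interface : Interface Atom
  truth : interface.Situation → Bool
  monotone : ∀ s t, interface.SituationLE s t → truth s ≤ truth t

namespace Formula

variable {Atom : Type u}

/-- The sequence of ports corresponding to the oliterals of a formula, in order of appearance. -/
def interface : Formula Atom → Interface Atom
  | .atom P => ⟨1, fun _ => .output P⟩
  | .negAtom P => ⟨1, fun _ => .input P⟩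
  | .conj F G => F.interface.append G.interface
  | .disj F G => F.interface.append G.interface

/-- Truth of a formula in a situation, that is, an assignment of truth values to its oatoms
(occurrences of atoms, in order of appearance). -/
def truth : (F : Formula Atom) → F.interface.Situation → Bool
  | .atom _, s => s (0 : Fin 1)
  | .negAtom _, s => !(s (0 : Fin 1))
  | .conj F G, s =>
    F.truth (Interface.Situation.left (I := F.interface) (J := G.interface) s) &&
    G.truth (Interface.Situation.right (I := F.interface) (J := G.interface) s)
  | .disj F G, s =>
    F.truth (Interface.Situation.left (I := F.interface) (J := G.interface) s) ||
    G.truth (Interface.Situation.right (I := F.interface) (J := G.interface) s)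

theorem truth_mono : ∀ (F : Formula Atom) (s t : F.interface.Situation),
    F.interface.SituationLE s t → F.truth s ≤ F.truth t
  | .atom P, s, t, h => (h (0 : Fin 1)).1 ⟨P, rfl⟩
  | .negAtom P, s, t, h => by
    have h1 := (h (0 : Fin 1)).2 ⟨P, rfl⟩
    have key : ∀ a b : Bool, b ≤ a → (!a) ≤ (!b) := by decide
    exact key _ _ h1
  | .conj F G, s, t, h => by
    have h1 := F.truth_mono _ _ (Interface.SituationLE.left h)
    have h2 := G.truth_mono _ _ (Interface.SituationLE.right h)
    have key : ∀ a b c d : Bool, a ≤ b → c ≤ d → (a && c) ≤ (b && d) := by decide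
    exact key _ _ _ _ h1 h2
  | .disj F G, s, t, h => by
    have h1 := F.truth_mono _ _ (Interface.SituationLE.left h)
    have h2 := G.truth_mono _ _ (Interface.SituationLE.right h)
    have key : ∀ a b c d : Bool, a ≤ b → c ≤ d → (a || c) ≤ (b || d) := by decide
    exact key _ _ _ _ h1 h2

/-- The resource represented by a formula. -/
def resource (F : Formula Atom) : Resource Atom := ⟨F.interface, F.truth, F.truth_mono⟩

end Formula

namespace Cirquent

variable {Atom : Type u}

/-- The sequence of ports corresponding to the oliterals of a pool, in order of appearance. -/
def poolInterface : List (Formula Atom) → Interface Atom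
  | [] => Interface.nil
  | F :: L => F.interface.append (poolInterface L)

/-- The truth value, in a situation for a pool, of its oformula number `i`: the value of this
oformula in the corresponding part of the situation (`false` if there is no such oformula). -/
def oformulaTruth : (L : List (Formula Atom)) → (poolInterface L).Situation → ℕ → Bool
  | [], _, _ => false
  | F :: L, s, 0 =>
    F.truth (Interface.Situation.left (I := F.interface) (J := poolInterface L) s)
  | F :: L, s, i + 1 =>
    oformulaTruth L (Interface.Situation.right (I := F.interface) (J := poolInterface L) s) i

/-- Truth of a cirquent in a situation: every group contains a true oformula. -/
def truth (C : Cirquent Atom) (s : (poolInterface C.pool).Situation) : Bool :=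
  decide (∀ Γ ∈ C.str, ∃ i ∈ Γ, oformulaTruth C.pool s i = true)

theorem oformulaTruth_mono : ∀ (L : List (Formula Atom)) (s t : (poolInterface L).Situation),
    (poolInterface L).SituationLE s t → ∀ i, oformulaTruth L s i ≤ oformulaTruth L t i
  | [], _, _, _, _ => le_refl false
  | F :: _, _, _, h, 0 => F.truth_mono _ _ (Interface.SituationLE.left h)
  | _ :: L, _, _, h, i + 1 => oformulaTruth_mono L _ _ (Interface.SituationLE.right h) i

theorem truth_mono (C : Cirquent Atom) (s t : (poolInterface C.pool).Situation)
    (h : (poolInterface C.pool).SituationLE s t) : C.truth s ≤ C.truth t := by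
  unfold truth
  rw [Bool.le_iff_imp]
  intro hs
  rw [decide_eq_true_eq] at hs ⊢
  intro Γ hΓ
  obtain ⟨i, hi, hv⟩ := hs Γ hΓ
  exact ⟨i, hi, Bool.le_iff_imp.1 (oformulaTruth_mono C.pool s t h i) hv⟩

/-- The resource represented by a cirquent. -/
def resource (C : Cirquent Atom) : Resource Atom :=
  ⟨poolInterface C.pool, C.truth, C.truth_mono⟩

end Cirquent

namespace Resource

variable {Atom : Type u}

/-- Pairs of oports of a resource. -/
abbrev OportPair (α : Resource Atom) : Type := Fin α.interface.size × Fin α.interface.size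

/-- An allocation: a pair of an oinput and an ooutput of the same type. -/
def IsAllocation (α : Resource Atom) (a : α.OportPair) : Prop :=
  ∃ P : Atom, α.interface.port a.1 = .input P ∧ α.interface.port a.2 = .output P

/-- A pair `(X, Y)` utilizes `X` and `Y`. -/
def Utilizes (α : Resource Atom) (a : α.OportPair) (Z : Fin α.interface.size) : Prop :=
  Z = a.1 ∨ Z = a.2

/-- An arrangement: a set of allocations. -/
def IsArrangement (α : Resource Atom) (A : Set α.OportPair) : Prop :=
  ∀ a ∈ A, α.IsAllocation a

/-- No oport is utilized by more than one allocation. -/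
def Monogamous (α : Resource Atom) (A : Set α.OportPair) : Prop :=
  ∀ a ∈ A, ∀ b ∈ A, ∀ Z, α.Utilizes a Z → α.Utilizes b Z → a = b

/-- A situation is consistent with an arrangement if the value of the input of every allocation
is at most the value of its output. -/
def Consistent (α : Resource Atom) (s : α.interface.Situation) (A : Set α.OportPair) : Prop :=
  ∀ a ∈ A, s a.1 ≤ s a.2

/-- The resource is true in every situation consistent with the arrangement. -/
def Trivializing (α : Resource Atom) (A : Set α.OportPair) : Prop :=
  ∀ s : α.interface.Situation, α.Consistent s A → α.truth s = true

/-- A resource is trivial if it has a monogamous trivializing arrangement. -/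
def Trivial (α : Resource Atom) : Prop :=
  ∃ A : Set α.OportPair, α.IsArrangement A ∧ α.Monogamous A ∧ α.Trivializing A

end Resource

end CirquentCalculus

/-! The bridge between proofs and arrangements is `IsBinaryInstance`: a cirquent is a substitution
instance of a binary tautology, that is, of a tautological cirquent in which every atom occurs at
most once positively and at most once negatively. Both provability and triviality are equivalent to
it.

Triviality: a monogamous arrangement is a matching of inputs with outputs of the same type. Giving
matched oports a common label and all others private labels turns it into a binary cirquent of which
the given one is an instance; conversely, equal labels on opposite oports form a monogamous
arrangement. Valuations of the labels are situations consistent with the arrangement, and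
monotonicity reduces an arbitrary consistent situation to one of these
(`isBinaryInstance_of_trivial`, `trivial_of_isBinaryInstance`).

Soundness: the axioms are instances of binary tautologies, and every rule preserves this, since no
rule duplicates an oformula; contraction would break it. Premises of mix are kept apart by
relabelling (`CL5.isBinaryInstance`).

Completeness: the introduction rules for `∨` and `∧` can be inverted on tautologies, so a binary
tautology reduces to one whose pool consists of distinct literals. There every group contains a
complementary pair, and such a cirquent comes from atomic identity axioms by mix, weakening,
exchange and duplication (`provable_of_literals`, `provable_of_sat`). Proofs are closed under
substitution (`CL5.map`), which carries the binary tautology to its instance. -/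

namespace CirquentCalculus

universe u v

variable {A : Type u} {B : Type v}

/-! ### Ports -/

/-- The type of a port. -/
def Port.type : Port A → A
  | .output P => P
  | .input P => P

/-- The port of the same polarity and of a given type. -/
def Port.retype : Port A → B → Port B
  | .output _, b => .output b
  | .input _, b => .input b

/-- The port of the same type and of the opposite polarity. -/
def Port.flip : Port A → Port A
  | .output P => .input P
  | .input P => .output P

/-- Apply a function to the type of a port. -/
def Port.map (f : A → B) : Port A → Port B
  | .output P => .output (f P)
  | .input P => .input (f P)

theorem Port.type_flip (x : Port A) : x.flip.type = x.type := by cases x <;> rfl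

theorem Port.flip_ne (x : Port A) : x.flip ≠ x := by cases x <;> simp [Port.flip]

theorem Port.flip_injective : Function.Injective (Port.flip : Port A → Port A) := by
  intro x y h
  cases x <;> cases y <;> simp_all [Port.flip]

theorem Port.type_map (f : A → B) (x : Port A) : (x.map f).type = f x.type := by cases x <;> rfl

theorem Port.type_retype (x : Port A) (b : B) : (x.retype b).type = b := by cases x <;> rfl

theorem Port.map_injective {f : A → B} (hf : Function.Injective f) :
    Function.Injective (Port.map f) := by
  intro x y h
  cases x <;> cases y <;> simp_all [Port.map, hf.eq_iff]

/-! ### Formulas: valuations, substitution, relabelling by occurrence -/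

namespace Formula

/-- Apply a function to all atoms of a formula. -/
def map (f : A → B) : Formula A → Formula B
  | .atom P => .atom (f P)
  | .negAtom P => .negAtom (f P)
  | .conj F G => .conj (F.map f) (G.map f)
  | .disj F G => .disj (F.map f) (G.map f)

/-- Classical truth of a formula under a valuation of its atoms. -/
def Holds (v : A → Prop) : Formula A → Prop
  | .atom P => v P
  | .negAtom P => ¬ v P
  | .conj F G => F.Holds v ∧ G.Holds v
  | .disj F G => F.Holds v ∨ G.Holds v

/-- The ports corresponding to the literal occurrences of a formula. -/
def ports : Formula A → List (Port A)
  | .atom P => [.output P]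
  | .negAtom P => [.input P]
  | .conj F G => F.ports ++ G.ports
  | .disj F G => F.ports ++ G.ports

/-- Replace the atoms of a formula, occurrence by occurrence. -/
def label : (F : Formula A) → (Fin F.interface.size → B) → Formula B
  | .atom _, l => .atom (l (0 : Fin 1))
  | .negAtom _, l => .negAtom (l (0 : Fin 1))
  | .conj F G, l => .conj (F.label fun i => l (Fin.castAdd G.interface.size i))
      (G.label fun i => l (Fin.natAdd F.interface.size i))
  | .disj F G, l => .disj (F.label fun i => l (Fin.castAdd G.interface.size i))
      (G.label fun i => l (Fin.natAdd F.interface.size i))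

theorem map_not (f : A → B) (F : Formula A) : F.not.map f = (F.map f).not := by
  induction F <;> simp_all [Formula.not, map]

theorem holds_not (v : A → Prop) (F : Formula A) : F.not.Holds v ↔ ¬ F.Holds v := by
  induction F <;> simp_all [Formula.not, Holds, imp_iff_not_or]

theorem map_map {D : Type*} (f : A → B) (g : B → D) (F : Formula A) :
    (F.map f).map g = F.map (g ∘ f) := by
  induction F <;> simp_all [map]

theorem holds_map (f : A → B) (v : B → Prop) (F : Formula A) :
    (F.map f).Holds v ↔ F.Holds (v ∘ f) := by
  induction F <;> simp_all [map, Holds]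

theorem ports_map (f : A → B) (F : Formula A) : (F.map f).ports = F.ports.map (Port.map f) := by
  induction F <;> simp_all [map, ports, Port.map]

theorem ports_not (F : Formula A) : F.not.ports = F.ports.map Port.flip := by
  induction F <;> simp_all [Formula.not, ports, Port.flip]

/-- Links the list of literals to the indexed interface, so that absence of repeated literals
becomes injectivity of a function on oports. -/
theorem ports_label (F : Formula A) (l : Fin F.interface.size → B) :
    (F.label l).ports = List.ofFn fun i => (F.interface.port i).retype (l i) := by
  induction F with
  | atom P => rfl
  | negAtom P => rfl
  | conj F G hF hG =>
    refine Eq.trans ?_ (List.ofFn_add (m := G.interface.size) (n := F.interface.size)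
      (f := fun i => ((Formula.conj F G).interface.port i).retype (l i))).symm
    simp [label, ports, hF, hG, interface, Interface.append]
    rfl
  | disj F G hF hG =>
    refine Eq.trans ?_ (List.ofFn_add (m := G.interface.size) (n := F.interface.size)
      (f := fun i => ((Formula.disj F G).interface.port i).retype (l i))).symm
    simp [label, ports, hF, hG, interface, Interface.append]
    rfl

theorem map_label (f : B → A) (F : Formula A) (l : Fin F.interface.size → B)
    (h : ∀ i, f (l i) = (F.interface.port i).type) : (F.label l).map f = F := by
  induction F with
  | atom P => exact congrArg _ (h (0 : Fin 1))
  | negAtom P => exact congrArg _ (h (0 : Fin 1))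
  | conj F G hF hG =>
    refine congrArg₂ Formula.conj (hF _ fun i => ?_) (hG _ fun i => ?_)
    · simpa [interface, Interface.append] using h (Fin.castAdd G.interface.size i)
    · simpa [interface, Interface.append] using h (Fin.natAdd F.interface.size i)
  | disj F G hF hG =>
    refine congrArg₂ Formula.disj (hF _ fun i => ?_) (hG _ fun i => ?_)
    · simpa [interface, Interface.append] using h (Fin.castAdd G.interface.size i)
    · simpa [interface, Interface.append] using h (Fin.natAdd F.interface.size i)

/-- Turns an abstract preimage under substitution into labels placed on the oports of the image. -/
theorem exists_label_map (f : B → A) (F : Formula B) :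
    ∃ l : Fin (F.map f).interface.size → B, (F.map f).label l = F ∧
      ∀ i, f (l i) = ((F.map f).interface.port i).type := by
  induction F with
  | atom P => exact ⟨fun _ => P, rfl, fun _ => rfl⟩
  | negAtom P => exact ⟨fun _ => P, rfl, fun _ => rfl⟩
  | conj F G hF hG =>
    obtain ⟨l, hl, hl'⟩ := hF
    obtain ⟨m, hm, hm'⟩ := hG
    refine ⟨Fin.append l m, ?_, ?_⟩
    · simp [map, label, hl, hm]
    · refine Fin.addCases (fun i => ?_) (fun i => ?_)
      · simpa [map, interface, Interface.append] using hl' i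
      · simpa [map, interface, Interface.append] using hm' i
  | disj F G hF hG =>
    obtain ⟨l, hl, hl'⟩ := hF
    obtain ⟨m, hm, hm'⟩ := hG
    refine ⟨Fin.append l m, ?_, ?_⟩
    · simp [map, label, hl, hm]
    · refine Fin.addCases (fun i => ?_) (fun i => ?_)
      · simpa [map, interface, Interface.append] using hl' i
      · simpa [map, interface, Interface.append] using hm' i

open Classical in
theorem holds_label (v : B → Prop) (F : Formula A) (l : Fin F.interface.size → B) :
    (F.label l).Holds v ↔ F.truth (fun i => decide (v (l i))) = true := by
  induction F with
  | atom P => simp [label, Holds, truth]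
  | negAtom P => simp [label, Holds, truth]
  | conj F G hF hG => simp [label, Holds, truth, hF, hG]; rfl
  | disj F G hF hG => simp [label, Holds, truth, hF, hG]; rfl

/-- Each occurrence is labelled by its own position. The types themselves are distinct, not just the
ports, so the literals of the result and of its negation are disjoint. -/
theorem exists_fresh (F : Formula A) :
    ∃ F' : Formula (A × ℕ), F'.map Prod.fst = F ∧ (F'.ports.map Port.type).Nodup := by
  refine ⟨F.label fun i => ((F.interface.port i).type, (i : ℕ)), map_label _ _ _ fun _ => rfl, ?_⟩
  rw [ports_label, List.map_ofFn, List.nodup_ofFn]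
  intro i j h
  simp only [Function.comp, Port.type_retype, Prod.mk.injEq] at h
  exact Fin.ext h.2

end Formula

/-! ### Pools: relabelling and truth by position -/

namespace Cirquent

/-- Replace the atoms of a pool, occurrence by occurrence. -/
def labelPool : (p : List (Formula A)) → (Fin (poolInterface p).size → B) → List (Formula B)
  | [], _ => []
  | F :: p, l => F.label (fun i => l (Fin.castAdd (poolInterface p).size i)) ::
      labelPool p fun i => l (Fin.natAdd F.interface.size i)

theorem ports_labelPool (p : List (Formula A)) (l : Fin (poolInterface p).size → B) :
    (labelPool p l).flatMap Formula.ports =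
      List.ofFn fun i => ((poolInterface p).port i).retype (l i) := by
  induction p with
  | nil => exact List.ofFn_zero.symm
  | cons F p ih =>
    refine Eq.trans ?_ (List.ofFn_add (m := (poolInterface p).size) (n := F.interface.size)
      (f := fun i => ((poolInterface (F :: p)).port i).retype (l i))).symm
    simp [labelPool, Formula.ports_label, ih, poolInterface, Interface.append]
    rfl

theorem map_labelPool (f : B → A) (p : List (Formula A)) (l : Fin (poolInterface p).size → B)
    (h : ∀ i, f (l i) = ((poolInterface p).port i).type) :
    (labelPool p l).map (Formula.map f) = p := by
  induction p with
  | nil => rfl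
  | cons F p ih =>
    refine congrArg₂ List.cons (Formula.map_label _ _ _ fun i => ?_) (ih _ fun i => ?_)
    · simpa [poolInterface, Interface.append] using h (Fin.castAdd (poolInterface p).size i)
    · simpa [poolInterface, Interface.append] using h (Fin.natAdd F.interface.size i)

theorem exists_labelPool_map (f : B → A) (p : List (Formula B)) :
    ∃ l : Fin (poolInterface (p.map (Formula.map f))).size → B,
      labelPool (p.map (Formula.map f)) l = p ∧
      ∀ i, f (l i) = ((poolInterface (p.map (Formula.map f))).port i).type := by
  induction p with
  | nil => exact ⟨Fin.elim0, rfl, fun i => Fin.elim0 i⟩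
  | cons F p ih =>
    obtain ⟨l, hl, hl'⟩ := Formula.exists_label_map f F
    obtain ⟨m, hm, hm'⟩ := ih
    refine ⟨Fin.append l m, ?_, ?_⟩
    · refine congrArg₂ List.cons ?_ ?_ <;> simp [hl, hm]
    · refine Fin.addCases (fun i => ?_) (fun i => ?_)
      · refine (congrArg f (Fin.append_left l m i)).trans ((hl' i).trans ?_)
        exact congrArg Port.type (Fin.append_left (Formula.map f F).interface.port _ i).symm
      · refine (congrArg f (Fin.append_right l m i)).trans ((hm' i).trans ?_)
        exact congrArg Port.type (Fin.append_right (Formula.map f F).interface.port _ i).symm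

/-- The oformula number `i` of a pool exists and is true under a valuation of the atoms. -/
def HoldsAt (v : A → Prop) (p : List (Formula A)) (i : ℕ) : Prop :=
  ∃ F, p[i]? = some F ∧ F.Holds v

open Classical in
theorem holdsAt_labelPool (v : B → Prop) (p : List (Formula A))
    (l : Fin (poolInterface p).size → B) (i : ℕ) :
    HoldsAt v (labelPool p l) i ↔ oformulaTruth p (fun i => decide (v (l i))) i = true := by
  induction p generalizing i with
  | nil => simp [HoldsAt, labelPool, oformulaTruth]
  | cons F p ih =>
    cases i with
    | zero => simp [HoldsAt, labelPool, oformulaTruth, Formula.holds_label]; rfl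
    | succ i =>
      have := ih (fun i => l (Fin.natAdd F.interface.size i)) i
      simp only [HoldsAt, labelPool, List.getElem?_cons_succ, oformulaTruth] at this ⊢
      rw [this]; rfl

/-! ### Triviality and instances of binary tautologies -/

/-- Every group contains an oformula that is true under a valuation of the atoms. -/
def Sat (v : A → Prop) (p : List (Formula A)) (S : List (Finset ℕ)) : Prop :=
  ∀ Γ ∈ S, ∃ i ∈ Γ, HoldsAt v p i

/-- Being a substitution instance of a binary tautology: the atoms of the pool can be renamed,
occurrence by occurrence, so that no literal occurs twice and that the result is a tautology. -/
def IsBinaryInstance (p : List (Formula A)) (S : List (Finset ℕ)) : Prop :=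
  ∃ p' : List (Formula (A × ℕ)), p'.map (Formula.map Prod.fst) = p ∧
    (p'.flatMap Formula.ports).Nodup ∧ ∀ v, Sat v p' S

open Classical in
theorem trivial_of_isBinaryInstance {C : Cirquent A} (h : IsBinaryInstance C.pool C.str) :
    C.resource.Trivial := by
  obtain ⟨p, S, hC⟩ := C
  obtain ⟨p', rfl, hnd, hsat⟩ := h
  obtain ⟨l, hl, htype⟩ := exists_labelPool_map Prod.fst p'
  have hinj : Function.Injective fun i =>
      ((poolInterface (p'.map (Formula.map Prod.fst))).port i).retype (l i) := by
    rw [← List.nodup_ofFn, ← ports_labelPool, hl]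
    exact hnd
  -- Allocate an input to an output exactly when they carry the same label. By `hinj` a label
  -- determines at most one input and at most one output, whence monogamy.
  refine ⟨{a | l a.1 = l a.2 ∧ (∃ P, (poolInterface (p'.map (Formula.map Prod.fst))).port a.1 =
      .input P) ∧ ∃ P, (poolInterface (p'.map (Formula.map Prod.fst))).port a.2 = .output P},
      ?_, ?_, ?_⟩
  · rintro ⟨X, Y⟩ ⟨hXY, ⟨P, hP⟩, Q, hQ⟩
    have h1 := htype X
    have h2 := htype Y
    simp only at hP hQ hXY
    rw [hP] at h1
    rw [hQ] at h2
    rw [hXY, h2] at h1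
    simp only [Port.type] at h1
    subst h1
    exact ⟨Q, hP, hQ⟩
  · rintro ⟨X, Y⟩ ⟨hXY, ⟨P, hP⟩, Q, hQ⟩ ⟨X', Y'⟩ ⟨hXY', ⟨P', hP'⟩, Q', hQ'⟩ Z hZ hZ'
    simp only [Resource.Utilizes] at hP hQ hXY hP' hQ' hXY' hZ hZ'
    rcases hZ with rfl | rfl <;> rcases hZ' with rfl | rfl
    · have : Y = Y' := hinj (by simp [hQ, hQ', Port.retype, ← hXY, ← hXY'])
      rw [this]
    · rw [hP] at hQ'; cases hQ'
    · rw [hQ] at hP'; cases hP'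
    · have : X = X' := hinj (by simp [hP, hP', Port.retype, hXY, hXY'])
      rw [this]
  · intro s hs
    -- The valuation copies the values of the inputs. Consistency makes every output at least as
    -- true in `s` as under `v`, so the situation induced by `v` lies below `s` and monotonicity
    -- applies.
    obtain ⟨v, hv⟩ : ∃ v : A × ℕ → Prop, ∀ b, v b ↔ ∃ X, l X = b ∧
        (∃ P, (poolInterface (p'.map (Formula.map Prod.fst))).port X = .input P) ∧ s X = true :=
      ⟨_, fun _ => Iff.rfl⟩
    refine Bool.le_iff_imp.1 (truth_mono ⟨_, S, hC⟩ (fun i => decide (v (l i))) s ?_) ?_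
    · intro i
      refine ⟨fun hi => ?_, fun hi => ?_⟩
      · rw [Bool.le_iff_imp, decide_eq_true_eq, hv]
        rintro ⟨X, hX, hX', hX''⟩
        exact Bool.le_iff_imp.1 (hs (X, i) ⟨hX, hX', hi⟩) hX''
      · rw [Bool.le_iff_imp, decide_eq_true_eq, hv]
        exact fun h => ⟨i, rfl, hi, h⟩
    · rw [truth, decide_eq_true_eq]
      intro Γ hΓ
      obtain ⟨i, hi, h⟩ := hsat v Γ hΓ
      rw [← hl, holdsAt_labelPool] at h
      exact ⟨i, hi, h⟩

theorem isBinaryInstance_of_trivial {C : Cirquent A} (h : C.resource.Trivial) :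
    IsBinaryInstance C.pool C.str := by
  classical
  obtain ⟨Al, hAl, hmono, htriv⟩ := h
  let I := poolInterface C.pool
  -- A utilized output is sent to its input; every other oport is fixed. Labelling by type and `g`
  -- identifies exactly the two ends of each allocation.
  let g : Fin I.size → Fin I.size := fun Y => if h : ∃ X, (X, Y) ∈ Al then h.choose else Y
  have hg : ∀ X Y, (X, Y) ∈ Al → g Y = X := by
    intro X Y hXY
    have h : ∃ X, (X, Y) ∈ Al := ⟨X, hXY⟩
    have := hmono _ h.choose_spec _ hXY Y (Or.inr rfl) (Or.inr rfl)
    exact (dif_pos h).trans (congrArg Prod.fst this)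
  have hg' : ∀ Y, (g Y, Y) ∈ Al ∨ g Y = Y := by
    intro Y
    by_cases h : ∃ X, (X, Y) ∈ Al
    · left
      have : g Y = h.choose := dif_pos h
      rw [this]
      exact h.choose_spec
    · exact Or.inr (dif_neg h)
  have hgin : ∀ X P, I.port X = .input P → g X = X := by
    intro X P hP
    rcases hg' X with h | h
    · obtain ⟨Q, -, hQ⟩ := hAl _ h
      exact absurd (hP.symm.trans hQ) (by simp)
    · exact h
  let l : Fin I.size → A × ℕ := fun i => ((I.port i).type, (g i : ℕ))
  refine ⟨labelPool C.pool l, map_labelPool _ _ _ fun _ => rfl, ?_, ?_⟩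
  · rw [ports_labelPool, List.nodup_ofFn]
    intro i j hij
    change (I.port i).retype (l i) = (I.port j).retype (l j) at hij
    have hgij : g i = g j := by
      have := congrArg Port.type hij
      rw [Port.type_retype, Port.type_retype] at this
      exact Fin.ext (congrArg Prod.snd this)
    cases hi : I.port i with
    | input P =>
      cases hj : I.port j with
      | input Q => rwa [hgin _ _ hi, hgin _ _ hj] at hgij
      | output Q => simp [hi, hj, Port.retype] at hij
    | output P =>
      cases hj : I.port j with
      | input Q => simp [hi, hj, Port.retype] at hij
      | output Q =>
        -- Two outputs sharing an input coincide by monogamy. In the mixed cases one value of `g` is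
        -- an input and the other an output.
        rcases hg' i with h | h <;> rcases hg' j with h' | h'
        · rw [hgij] at h
          exact congrArg Prod.snd (hmono _ h _ h' (g j) (Or.inl rfl) (Or.inl rfl))
        · obtain ⟨R, hR, -⟩ := hAl _ h
          rw [hgij, h'] at hR
          exact absurd (hj.symm.trans hR) (by simp)
        · obtain ⟨R, hR, -⟩ := hAl _ h'
          rw [← hgij, h] at hR
          exact absurd (hi.symm.trans hR) (by simp)
        · rw [← h, ← h', hgij]
  · intro v Γ hΓ
    -- The two ends of an allocation have equal labels, hence equal values, so this situation is
    -- consistent.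
    have hs := htriv (fun i => decide (v (l i))) (by
      rintro ⟨X, Y⟩ hXY
      obtain ⟨P, hP, hQ⟩ := hAl _ hXY
      have : l X = l Y := by
        have h1 := hg _ _ hXY
        change I.port X = _ at hP
        change I.port Y = _ at hQ
        simp only [l, hP, hQ, Port.type, h1, hgin _ _ hP]
      simp only [this, le_refl])
    change C.truth _ = true at hs
    unfold truth at hs
    rw [decide_eq_true_eq] at hs
    obtain ⟨i, hi, h⟩ := hs Γ hΓ
    exact ⟨i, hi, (holdsAt_labelPool v _ l i).2 h⟩

theorem trivial_singleton_iff (F : Formula A) :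
    (singleton F).resource.Trivial ↔ F.resource.Trivial := by
  have hport : (poolInterface [F]).port = F.interface.port :=
    funext fun i => Fin.append_left F.interface.port Fin.elim0 i
  have htruth : ∀ s : F.interface.Situation, (singleton F).truth s = F.truth s := by
    intro s
    have : oformulaTruth [F] s 0 = F.truth s := rfl
    rw [Bool.eq_iff_iff]
    unfold truth
    rw [decide_eq_true_eq]
    simp [singleton, this]
  -- The two interfaces have definitionally equal sizes, but their port functions are only
  -- propositionally equal; generalizing them allows substitution.
  have key : ∀ (n : ℕ) (q q' : Fin n → Port A) (t t' : (Fin n → Bool) → Bool) (h h'), q = q' →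
      t = t' → ((⟨⟨n, q⟩, t, h⟩ : Resource A).Trivial ↔
        (⟨⟨n, q'⟩, t', h'⟩ : Resource A).Trivial) := by
    rintro n q _ t _ h h' rfl rfl
    rfl
  exact key F.interface.size _ _ _ _ _ _ hport (funext htruth)

end Cirquent

/-! ### Soundness: the rules preserve instances of binary tautologies -/

namespace Cirquent

section HoldsAt

variable {v : A → Prop} {p q : List (Formula A)} {F : Formula A} {i : ℕ}

theorem HoldsAt.lt_length (h : HoldsAt v p i) : i < p.length := by
  obtain ⟨F, hF, -⟩ := h
  exact (List.getElem?_eq_some_iff.1 hF).1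

theorem holdsAt_append_of_lt (h : i < p.length) : HoldsAt v (p ++ q) i ↔ HoldsAt v p i := by
  simp [HoldsAt, List.getElem?_append_left h]

theorem holdsAt_append_add : HoldsAt v (p ++ q) (p.length + i) ↔ HoldsAt v q i := by
  rw [HoldsAt, List.getElem?_append_right (Nat.le_add_right _ _), Nat.add_sub_cancel_left]
  rfl

theorem holdsAt_append_length : HoldsAt v (p ++ q) p.length ↔ HoldsAt v q 0 :=
  holdsAt_append_add (i := 0)

theorem holdsAt_cons_zero : HoldsAt v (F :: p) 0 ↔ F.Holds v := by simp [HoldsAt]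

theorem holdsAt_cons_succ : HoldsAt v (F :: p) (i + 1) ↔ HoldsAt v p i := by simp [HoldsAt]

theorem holdsAt_map {f : A → B} {v : B → Prop} :
    HoldsAt v (p.map (Formula.map f)) i ↔ HoldsAt (v ∘ f) p i := by
  simp [HoldsAt, Formula.holds_map]

end HoldsAt

theorem Sat.map_image {v : A → Prop} {w : B → Prop} {p : List (Formula A)} {q : List (Formula B)}
    {S : List (Finset ℕ)} {f : ℕ → ℕ} (h : Sat v p S)
    (hf : ∀ i, HoldsAt v p i → HoldsAt w q (f i)) :
    Sat w q (S.map fun Γ => Γ.image f) := by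
  intro Γ hΓ
  obtain ⟨Δ, hΔ, rfl⟩ := List.mem_map.1 hΓ
  obtain ⟨i, hi, hv⟩ := h Δ hΔ
  exact ⟨f i, Finset.mem_image_of_mem f hi, hf i hv⟩

theorem Sat.mono {v : A → Prop} {p : List (Formula A)} {S T : List (Finset ℕ)}
    (h : Sat v p S) (hST : ∀ Γ ∈ T, ∃ Δ ∈ S, Δ ⊆ Γ) : Sat v p T := by
  intro Γ hΓ
  obtain ⟨Δ, hΔ, hsub⟩ := hST Γ hΓ
  obtain ⟨i, hi, hv⟩ := h Δ hΔ
  exact ⟨i, hsub hi, hv⟩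

/-- Covers at once all rules that alter only the structure: ogroup exchange, ogroup weakening and
both duplications. -/
theorem IsBinaryInstance.mono {p : List (Formula A)} {S T : List (Finset ℕ)}
    (h : IsBinaryInstance p S) (hST : ∀ Γ ∈ T, ∃ Δ ∈ S, Δ ⊆ Γ) : IsBinaryInstance p T := by
  obtain ⟨p', h1, h2, h3⟩ := h
  exact ⟨p', h1, h2, fun v => (h3 v).mono hST⟩

theorem isBinaryInstance_identity (F : Formula A) :
    IsBinaryInstance [F.not, F] [{0, 1}] := by
  obtain ⟨F', rfl, hF'⟩ := F.exists_fresh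
  refine ⟨[F'.not, F'], by simp [Formula.map_not], ?_, fun v Γ hΓ => ?_⟩
  · have hnd : F'.ports.Nodup := hF'.of_map _
    simp only [List.flatMap_cons, List.flatMap_nil, List.append_nil, Formula.ports_not]
    refine List.Nodup.append (hnd.map Port.flip_injective) hnd ?_
    intro x hx hx'
    obtain ⟨y, hy, rfl⟩ := List.mem_map.1 hx
    exact y.flip_ne (List.inj_on_of_nodup_map hF' hx' hy y.type_flip)
  · obtain rfl := List.mem_singleton.1 hΓ
    by_cases h : F'.Holds v
    · exact ⟨1, by simp, F', rfl, h⟩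
    · exact ⟨0, by simp, F'.not, rfl, (F'.holds_not v).2 h⟩

/-- Rename the labels of a labelled atom by `2 * n + k`. -/
def spread (k : ℕ) (b : A × ℕ) : A × ℕ := (b.1, 2 * b.2 + k)

theorem spread_injective (k : ℕ) : Function.Injective (spread (A := A) k) := by
  rintro ⟨a, n⟩ ⟨b, m⟩ h
  simp only [spread, Prod.mk.injEq] at h ⊢
  exact ⟨h.1, by omega⟩

theorem map_fst_map_spread (k : ℕ) (p : List (Formula (A × ℕ))) :
    (p.map (Formula.map (spread k))).map (Formula.map Prod.fst) =
      p.map (Formula.map Prod.fst) := by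
  rw [List.map_map]
  exact List.map_congr_left fun F _ => Formula.map_map _ _ F

theorem ports_map_pool (f : A → B) (p : List (Formula A)) :
    (p.map (Formula.map f)).flatMap Formula.ports =
      (p.flatMap Formula.ports).map (Port.map f) := by
  simp [List.flatMap_map, List.map_flatMap, Formula.ports_map]

/-- Labels become even on one side and odd on the other, so the sides cannot clash; the original
atom in the first component is untouched. -/
theorem nodup_spread_append {l m : List (Port (A × ℕ))} (hl : l.Nodup) (hm : m.Nodup) :
    (l.map (Port.map (spread 0)) ++ m.map (Port.map (spread 1))).Nodup := by
  refine List.Nodup.append (hl.map (Port.map_injective (spread_injective 0)))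
    (hm.map (Port.map_injective (spread_injective 1))) ?_
  intro x hx hx'
  obtain ⟨y, -, rfl⟩ := List.mem_map.1 hx
  obtain ⟨z, -, hz⟩ := List.mem_map.1 hx'
  have := congrArg (fun x => x.type.2) hz
  simp only [Port.type_map, spread] at this
  omega

theorem IsBinaryInstance.mix {p q : List (Formula A)} {S T : List (Finset ℕ)}
    (hp : IsBinaryInstance p S) (hq : IsBinaryInstance q T) :
    IsBinaryInstance (p ++ q) (S ++ T.map fun Γ => Γ.image fun i => p.length + i) := by
  obtain ⟨p', rfl, hnp, hSp⟩ := hp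
  obtain ⟨q', rfl, hnq, hSq⟩ := hq
  refine ⟨p'.map (Formula.map (spread 0)) ++ q'.map (Formula.map (spread 1)), ?_, ?_, fun v => ?_⟩
  · rw [List.map_append, map_fst_map_spread, map_fst_map_spread]
  · rw [List.flatMap_append, ports_map_pool, ports_map_pool]
    exact nodup_spread_append hnp hnq
  · intro Γ hΓ
    rcases List.mem_append.1 hΓ with hΓ | hΓ
    · obtain ⟨i, hi, h⟩ := hSp (v ∘ spread 0) Γ hΓ
      rw [← holdsAt_map] at h
      exact ⟨i, hi, (holdsAt_append_of_lt h.lt_length).2 h⟩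
    · refine (hSq (v ∘ spread 1)).map_image (fun i h => ?_) Γ hΓ
      rw [← holdsAt_map] at h
      simpa using (holdsAt_append_add (p := p'.map (Formula.map (spread 0)))).2 h

theorem IsBinaryInstance.poolWeakening {L₁ L₂ : List (Formula A)} {S : List (Finset ℕ)}
    (F : Formula A) (h : IsBinaryInstance (L₁ ++ L₂) S) :
    IsBinaryInstance (L₁ ++ F :: L₂)
      (S.map fun Γ => Γ.image fun i => if i < L₁.length then i else i + 1) := by
  obtain ⟨p', hp, hnd, hsat⟩ := h
  obtain ⟨M₁, M₂, rfl, rfl, rfl⟩ := List.map_eq_append_iff.1 hp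
  obtain ⟨F', rfl, hF'⟩ := F.exists_fresh
  refine ⟨M₁.map (Formula.map (spread 0)) ++ F'.map (spread 1) :: M₂.map (Formula.map (spread 0)),
    ?_, ?_, fun v => ?_⟩
  · rw [List.map_append, List.map_cons, map_fst_map_spread, map_fst_map_spread, Formula.map_map]
    rfl
  · have := nodup_spread_append hnd (hF'.of_map _)
    rw [← ports_map_pool, ← Formula.ports_map] at this
    refine (List.Perm.nodup_iff ?_).1 this
    simp only [List.map_append, List.flatMap_append, List.flatMap_cons, List.append_assoc]
    exact (List.perm_append_comm).append_left _
  · refine (hsat (v ∘ spread 0)).map_image fun i h => ?_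
    rw [← holdsAt_map, List.map_append] at h
    have hlen : (M₁.map (Formula.map (spread 0))).length =
      (M₁.map (Formula.map Prod.fst)).length := by simp
    rw [← hlen]
    generalize M₁.map (Formula.map (spread 0)) = N₁ at h
    split_ifs with hi
    · rw [holdsAt_append_of_lt hi] at h ⊢
      exact h
    · obtain ⟨k, rfl⟩ := Nat.exists_eq_add_of_le (not_lt.1 hi)
      rw [holdsAt_append_add] at h
      rw [add_assoc, holdsAt_append_add, holdsAt_cons_succ]
      exact h

theorem getElem?_swap {α : Type*} (l m : List α) (x y : α) (i : ℕ) :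
    (l ++ y :: x :: m)[Equiv.swap l.length (l.length + 1) i]? = (l ++ x :: y :: m)[i]? := by
  rcases lt_or_ge i l.length with hi | hi
  · rw [Equiv.swap_apply_of_ne_of_ne (by omega) (by omega), List.getElem?_append_left hi,
      List.getElem?_append_left hi]
  · obtain ⟨k, rfl⟩ := Nat.exists_eq_add_of_le hi
    match k with
    | 0 => simp
    | 1 => simp
    | k + 2 =>
      rw [Equiv.swap_apply_of_ne_of_ne (by omega) (by omega),
        List.getElem?_append_right (by omega), List.getElem?_append_right (by omega),
        Nat.add_sub_cancel_left]
      rfl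

theorem HoldsAt.swap {v : A → Prop} {L₁ L₂ : List (Formula A)} {F G : Formula A} {i : ℕ}
    (h : HoldsAt v (L₁ ++ F :: G :: L₂) i) :
    HoldsAt v (L₁ ++ G :: F :: L₂) (Equiv.swap L₁.length (L₁.length + 1) i) := by
  rwa [HoldsAt, getElem?_swap]

theorem map_eq_append_cons_cons {f : A → B} {p : List A} {L₁ L₂ : List B} {F G : B}
    (h : p.map f = L₁ ++ F :: G :: L₂) : ∃ M₁ M₂ F' G', p = M₁ ++ F' :: G' :: M₂ ∧
      M₁.map f = L₁ ∧ f F' = F ∧ f G' = G ∧ M₂.map f = L₂ := by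
  obtain ⟨M₁, M, rfl, rfl, hM⟩ := List.map_eq_append_iff.1 h
  obtain ⟨F', N, rfl, rfl, hN⟩ := List.map_eq_cons_iff.1 hM
  obtain ⟨G', M₂, rfl, rfl, rfl⟩ := List.map_eq_cons_iff.1 hN
  exact ⟨M₁, M₂, F', G', rfl, rfl, rfl, rfl, rfl⟩

theorem IsBinaryInstance.swap {L₁ L₂ : List (Formula A)} {F G : Formula A} {S : List (Finset ℕ)}
    (h : IsBinaryInstance (L₁ ++ F :: G :: L₂) S) :
    IsBinaryInstance (L₁ ++ G :: F :: L₂)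
      (S.map fun Γ => Γ.image (Equiv.swap L₁.length (L₁.length + 1))) := by
  obtain ⟨p', hp, hnd, hsat⟩ := h
  obtain ⟨M₁, M₂, F', G', rfl, rfl, rfl, rfl, rfl⟩ := map_eq_append_cons_cons hp
  refine ⟨M₁ ++ G' :: F' :: M₂, by simp, ?_, fun v => ?_⟩
  · exact (((List.Perm.swap G' F' M₂).append_left M₁).flatMap_right _).nodup_iff.1 hnd
  · rw [List.length_map]
    exact (hsat v).map_image fun i h => h.swap

theorem holdsAt_merge {v : A → Prop} {L₁ L₂ : List (Formula A)} {F G H : Formula A} {i : ℕ}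
    (h : HoldsAt v (L₁ ++ F :: G :: L₂) i) (hF : i = L₁.length → H.Holds v)
    (hG : i = L₁.length + 1 → H.Holds v) :
    HoldsAt v (L₁ ++ H :: L₂) (if i ≤ L₁.length then i else i - 1) := by
  rcases lt_or_ge i L₁.length with hi | hi
  · rw [if_pos hi.le]
    rw [holdsAt_append_of_lt hi] at h ⊢
    exact h
  · obtain ⟨k, rfl⟩ := Nat.exists_eq_add_of_le hi
    rw [holdsAt_append_add] at h
    match k, h with
    | 0, h =>
      rw [if_pos (by simp), add_zero, holdsAt_append_length, holdsAt_cons_zero]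
      exact hF rfl
    | 1, h =>
      rw [if_neg (by omega), Nat.add_sub_cancel, holdsAt_append_length, holdsAt_cons_zero]
      exact hG rfl
    | k + 2, h =>
      rw [if_neg (by omega)]
      change HoldsAt v _ (L₁.length + (k + 1))
      rw [holdsAt_append_add]
      simpa only [holdsAt_cons_succ] using h

theorem HoldsAt.holds_left {v : A → Prop} {L₁ L₂ : List (Formula A)} {F : Formula A} {i : ℕ}
    (h : HoldsAt v (L₁ ++ F :: L₂) i) (hi : i = L₁.length) : F.Holds v := by
  subst hi
  exact holdsAt_cons_zero.1 (holdsAt_append_length.1 h)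

theorem HoldsAt.holds_right {v : A → Prop} {L₁ L₂ : List (Formula A)} {F G : Formula A} {i : ℕ}
    (h : HoldsAt v (L₁ ++ F :: G :: L₂) i) (hi : i = L₁.length + 1) : G.Holds v := by
  subst hi
  exact holdsAt_cons_zero.1 (holdsAt_cons_succ.1 (holdsAt_append_add.1 h))

theorem IsBinaryInstance.disjIntro {L₁ L₂ : List (Formula A)} {F G : Formula A}
    {S : List (Finset ℕ)} (h : IsBinaryInstance (L₁ ++ F :: G :: L₂) S) :
    IsBinaryInstance (L₁ ++ .disj F G :: L₂) (S.map (mergePositions L₁.length)) := by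
  obtain ⟨p', hp, hnd, hsat⟩ := h
  obtain ⟨M₁, M₂, F', G', rfl, rfl, rfl, rfl, rfl⟩ := map_eq_append_cons_cons hp
  refine ⟨M₁ ++ .disj F' G' :: M₂, by simp [Formula.map], ?_, fun v => ?_⟩
  · simpa [Formula.ports] using hnd
  · rw [List.length_map]
    exact (hsat v).map_image fun i h =>
      holdsAt_merge h (fun hi => Or.inl (h.holds_left hi)) (fun hi => Or.inr (h.holds_right hi))

/-- Records what soundness of `∧`-introduction needs: an unmerged group avoids both conjuncts, and a
merged one is a union whose first part lacks the right conjunct and whose second lacks the left. -/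
theorem mem_mergeGroups {n : ℕ} {S : List (Finset ℕ)} (h1 : ∀ Γ ∈ S, ¬ (n ∈ Γ ∧ n + 1 ∈ Γ))
    (h2 : ∀ (j : ℕ) (Γ : Finset ℕ), S[j]? = some Γ → n ∈ Γ →
      ∃ Δ : Finset ℕ, S[j + 1]? = some Δ ∧ n + 1 ∈ Δ)
    (h3 : ∀ (j : ℕ) (Δ : Finset ℕ), S[j]? = some Δ → n + 1 ∈ Δ →
      ∃ (k : ℕ) (Γ : Finset ℕ), k + 1 = j ∧ S[k]? = some Γ ∧ n ∈ Γ)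
    {Θ : Finset ℕ} (hΘ : Θ ∈ mergeGroups n S) :
    (Θ ∈ S ∧ n ∉ Θ ∧ n + 1 ∉ Θ) ∨
      ∃ Γ ∈ S, ∃ Δ ∈ S, n + 1 ∉ Γ ∧ n ∉ Δ ∧ Θ = Γ ∪ Δ := by
  -- The first ogroup has no predecessor. This passes to the tails met in the recursion because the
  -- ogroup just before such a tail does not contain `n`.
  have hhead : ∀ Γ, S[0]? = some Γ → n + 1 ∉ Γ := by
    intro Γ hΓ hn
    obtain ⟨k, -, hk, -⟩ := h3 0 Γ hΓ hn
    omega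
  induction S using mergeGroups.induct n with
  | case1 => simp [mergeGroups] at hΘ
  | case2 Γ =>
    simp only [mergeGroups, List.mem_singleton] at hΘ
    subst hΘ
    refine Or.inl ⟨by simp, fun hn => ?_, hhead _ rfl⟩
    obtain ⟨Δ, hΔ, -⟩ := h2 0 Θ rfl hn
    simp at hΔ
  | case3 Γ Δ S hn ih =>
    rw [mergeGroups, if_pos hn, List.mem_cons] at hΘ
    have hΔ : n + 1 ∈ Δ := by
      obtain ⟨Δ', h, h'⟩ := h2 0 Γ rfl hn
      simp only [zero_add, List.getElem?_cons_succ, List.getElem?_cons_zero,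
        Option.some.injEq] at h
      rwa [h]
    have hnΔ : n ∉ Δ := fun h => h1 Δ (by simp) ⟨h, hΔ⟩
    rcases hΘ with rfl | hΘ
    · exact Or.inr ⟨Γ, by simp, Δ, by simp, hhead _ rfl, hnΔ, rfl⟩
    · have h3' : ∀ (j : ℕ) (Δ : Finset ℕ), S[j]? = some Δ → n + 1 ∈ Δ →
          ∃ (k : ℕ) (Γ : Finset ℕ), k + 1 = j ∧ S[k]? = some Γ ∧ n ∈ Γ := by
        intro j E hE hnE
        obtain ⟨k, E', hk, hE', hnE'⟩ := h3 (j + 2) E hE hnE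
        match j, k, hk with
        | 0, 1, _ =>
          simp only [List.getElem?_cons_succ, List.getElem?_cons_zero, Option.some.injEq] at hE'
          exact absurd (hE' ▸ hnE') hnΔ
        | j + 1, k + 2, hk => exact ⟨k, E', by omega, hE', hnE'⟩
      rcases ih (fun E hE => h1 E (by simp [hE])) (fun j E hE => h2 (j + 2) E hE) h3' hΘ
        (fun E hE hnE => by obtain ⟨k, -, hk, -⟩ := h3' 0 E hE hnE; omega) with
        ⟨h, h'⟩ | ⟨E, hE, E', hE', h⟩
      · exact Or.inl ⟨by simp [h], h'⟩
      · exact Or.inr ⟨E, by simp [hE], E', by simp [hE'], h⟩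
  | case4 Γ Δ S hn ih =>
    rw [mergeGroups, if_neg hn, List.mem_cons] at hΘ
    rcases hΘ with rfl | hΘ
    · exact Or.inl ⟨by simp, hn, hhead _ rfl⟩
    · have h3' : ∀ (j : ℕ) (E : Finset ℕ), (Δ :: S)[j]? = some E → n + 1 ∈ E →
          ∃ (k : ℕ) (Γ : Finset ℕ), k + 1 = j ∧ (Δ :: S)[k]? = some Γ ∧ n ∈ Γ := by
        intro j E hE hnE
        obtain ⟨k, E', hk, hE', hnE'⟩ := h3 (j + 1) E hE hnE
        match j, k, hk with
        | 0, 0, _ =>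
          simp only [List.getElem?_cons_zero, Option.some.injEq] at hE'
          exact absurd (hE' ▸ hnE') hn
        | j + 1, k + 1, hk => exact ⟨k, E', by omega, hE', hnE'⟩
      rcases ih (fun E hE => h1 E (List.mem_cons_of_mem _ hE))
        (fun j E hE => h2 (j + 1) E hE) h3' hΘ
        (fun E hE hnE => by obtain ⟨k, -, hk, -⟩ := h3' 0 E hE hnE; omega) with
        ⟨h, h'⟩ | ⟨E, hE, E', hE', h⟩
      · exact Or.inl ⟨List.mem_cons_of_mem _ h, h'⟩
      · exact Or.inr ⟨E, List.mem_cons_of_mem _ hE, E', List.mem_cons_of_mem _ hE', h⟩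

theorem IsBinaryInstance.conjIntro {L₁ L₂ : List (Formula A)} {F G : Formula A}
    {S : List (Finset ℕ)} (h : IsBinaryInstance (L₁ ++ F :: G :: L₂) S)
    (h1 : ∀ Γ ∈ S, ¬ (L₁.length ∈ Γ ∧ L₁.length + 1 ∈ Γ))
    (h2 : ∀ (j : ℕ) (Γ : Finset ℕ), S[j]? = some Γ → L₁.length ∈ Γ →
      ∃ Δ : Finset ℕ, S[j + 1]? = some Δ ∧ L₁.length + 1 ∈ Δ)
    (h3 : ∀ (j : ℕ) (Δ : Finset ℕ), S[j]? = some Δ → L₁.length + 1 ∈ Δ →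
      ∃ (k : ℕ) (Γ : Finset ℕ), k + 1 = j ∧ S[k]? = some Γ ∧ L₁.length ∈ Γ) :
    IsBinaryInstance (L₁ ++ .conj F G :: L₂)
      ((mergeGroups L₁.length S).map (mergePositions L₁.length)) := by
  obtain ⟨p', hp, hnd, hsat⟩ := h
  obtain ⟨M₁, M₂, F', G', rfl, rfl, rfl, rfl, rfl⟩ := map_eq_append_cons_cons hp
  refine ⟨M₁ ++ .conj F' G' :: M₂, by simp [Formula.map], ?_, fun v => ?_⟩
  · simpa [Formula.ports] using hnd
  · rw [List.length_map] at *
    intro Θ' hΘ'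
    obtain ⟨Θ, hΘ, rfl⟩ := List.mem_map.1 hΘ'
    suffices ∃ i ∈ Θ, HoldsAt v (M₁ ++ .conj F' G' :: M₂) (if i ≤ M₁.length then i else i - 1) by
      obtain ⟨i, hi, h⟩ := this
      exact ⟨_, Finset.mem_image_of_mem _ hi, h⟩
    rcases mem_mergeGroups h1 h2 h3 hΘ with ⟨hΘS, hn, hn'⟩ | ⟨Γ, hΓ, Δ, hΔ, hnΓ, hnΔ, rfl⟩
    · obtain ⟨i, hi, h⟩ := hsat v Θ hΘS
      exact ⟨i, hi, holdsAt_merge h (fun e => absurd (e ▸ hi) hn) (fun e => absurd (e ▸ hi) hn')⟩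
    · obtain ⟨i, hi, h⟩ := hsat v Γ hΓ
      obtain ⟨j, hj, h'⟩ := hsat v Δ hΔ
      -- If the true oformula of `Γ` is not the left conjunct, it survives unchanged. If it is, use
      -- the one of `Δ`: either it survives, or it is the right conjunct and the conjunction is
      -- true.
      by_cases e : i = M₁.length
      · refine ⟨j, Finset.mem_union_right _ hj, holdsAt_merge h' (fun e' => absurd (e' ▸ hj) hnΔ)
          fun e' => ⟨h.holds_left e, h'.holds_right e'⟩⟩
      · exact ⟨i, Finset.mem_union_left _ hi, holdsAt_merge h (fun e' => absurd e' e)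
          fun e' => absurd (e' ▸ hi) hnΓ⟩

end Cirquent

theorem CL5.isBinaryInstance {C : Cirquent A} (h : CL5 C) :
    Cirquent.IsBinaryInstance C.pool C.str := by
  induction h with
  | empty => exact ⟨[], rfl, List.nodup_nil, fun v Γ hΓ => by simp [Cirquent.empty] at hΓ⟩
  | identity F => exact Cirquent.isBinaryInstance_identity F
  | mix hE _ _ hC hD =>
    rw [hE.1, hE.2]
    exact hC.mix hD
  | oformulaExchange hD _ hC =>
    obtain ⟨L₁, L₂, F, G, h1, h2, h3⟩ := hD
    rw [h2, h3]
    rw [h1] at hC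
    exact hC.swap
  | ogroupExchange hD _ hC =>
    obtain ⟨S₁, S₂, Γ, Δ, h1, h2, h3⟩ := hD
    rw [h2, h3]
    rw [h1] at hC
    refine hC.mono fun E hE => ⟨E, ?_, subset_rfl⟩
    simp only [List.mem_append, List.mem_cons] at hE ⊢
    tauto
  | ogroupWeakening hD _ hC =>
    obtain ⟨S₁, S₂, Γ, i, -, -, h1, h2, h3⟩ := hD
    rw [h2, h3]
    rw [h1] at hC
    refine hC.mono fun E hE => ?_
    simp only [List.mem_append, List.mem_cons] at hE
    rcases hE with hE | rfl | hE
    · exact ⟨E, by simp [hE], subset_rfl⟩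
    · exact ⟨Γ, by simp, Finset.subset_insert i Γ⟩
    · exact ⟨E, by simp [hE], subset_rfl⟩
  | poolWeakening hD _ hC =>
    obtain ⟨L₁, L₂, F, h1, h2, h3⟩ := hD
    rw [h2, h3]
    rw [h1] at hC
    exact hC.poolWeakening F
  | downwardDuplication hD _ hC =>
    obtain ⟨S₁, S₂, Γ, h1, h2, h3⟩ := hD
    rw [h2, h3]
    rw [h1] at hC
    refine hC.mono fun E hE => ⟨E, ?_, subset_rfl⟩
    simp only [List.mem_append, List.mem_cons] at hE ⊢
    tauto
  | upwardDuplication hD _ hC =>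
    obtain ⟨S₁, S₂, Γ, h1, h2, h3⟩ := hD
    rw [h1, ← h3]
    rw [h2] at hC
    refine hC.mono fun E hE => ⟨E, ?_, subset_rfl⟩
    simp only [List.mem_append, List.mem_cons] at hE ⊢
    tauto
  | disjIntro hD _ hC =>
    obtain ⟨L₁, L₂, F, G, h1, h2, h3⟩ := hD
    rw [h2, h3]
    rw [h1] at hC
    exact hC.disjIntro
  | conjIntro hD _ hC =>
    obtain ⟨L₁, L₂, F, G, h1, h2, h3, h4, h5, h6⟩ := hD
    rw [h5, h6]
    rw [h1] at hC
    exact hC.conjIntro h2 h3 h4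

/-! ### Closure of provability under substitution -/

namespace Cirquent

/-- Apply a function to all atoms of a cirquent. -/
def map (f : A → B) (C : Cirquent A) : Cirquent B where
  pool := C.pool.map (Formula.map f)
  str := C.str
  lt_of_mem := by simpa using C.lt_of_mem

theorem eq_of_pool_str : ∀ {C D : Cirquent A}, C.pool = D.pool → C.str = D.str → C = D
  | ⟨_, _, _⟩, ⟨_, _, _⟩, rfl, rfl => rfl

end Cirquent

theorem CL5.map (f : A → B) {C : Cirquent A} (h : CL5 C) : CL5 (C.map f) := by
  induction h with
  | empty => exact CL5.empty
  | identity F =>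
    have : (Cirquent.identity F).map f = Cirquent.identity (F.map f) :=
      Cirquent.eq_of_pool_str (by simp [Cirquent.map, Cirquent.identity, Formula.map_not]) rfl
    rw [this]
    exact CL5.identity _
  | mix hE _ _ hC hD =>
    refine CL5.mix ⟨?_, ?_⟩ hC hD
    · simp [Cirquent.map, hE.1]
    · simp [Cirquent.map, hE.2]
  | oformulaExchange hD _ hC =>
    obtain ⟨L₁, L₂, F, G, h1, h2, h3⟩ := hD
    exact CL5.oformulaExchange ⟨L₁.map (Formula.map f), L₂.map (Formula.map f), F.map f, G.map f,
      by simp [Cirquent.map, h1], by simp [Cirquent.map, h2], by simp [Cirquent.map, h3]⟩ hC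
  | ogroupExchange hD _ hC =>
    obtain ⟨S₁, S₂, Γ, Δ, h1, h2, h3⟩ := hD
    exact CL5.ogroupExchange ⟨S₁, S₂, Γ, Δ, h1, h2, by simp [Cirquent.map, h3]⟩ hC
  | ogroupWeakening hD _ hC =>
    obtain ⟨S₁, S₂, Γ, i, hi, hi', h1, h2, h3⟩ := hD
    exact CL5.ogroupWeakening ⟨S₁, S₂, Γ, i, by simpa [Cirquent.map] using hi, hi', h1, h2,
      by simp [Cirquent.map, h3]⟩ hC
  | poolWeakening hD _ hC =>
    obtain ⟨L₁, L₂, F, h1, h2, h3⟩ := hD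
    exact CL5.poolWeakening ⟨L₁.map (Formula.map f), L₂.map (Formula.map f), F.map f,
      by simp [Cirquent.map, h1], by simp [Cirquent.map, h2], by simp [Cirquent.map, h3]⟩ hC
  | downwardDuplication hD _ hC =>
    obtain ⟨S₁, S₂, Γ, h1, h2, h3⟩ := hD
    exact CL5.downwardDuplication ⟨S₁, S₂, Γ, h1, h2, by simp [Cirquent.map, h3]⟩ hC
  | upwardDuplication hD _ hC =>
    obtain ⟨S₁, S₂, Γ, h1, h2, h3⟩ := hD
    exact CL5.upwardDuplication ⟨S₁, S₂, Γ, h1, h2, by simp [Cirquent.map, h3]⟩ hC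
  | disjIntro hD _ hC =>
    obtain ⟨L₁, L₂, F, G, h1, h2, h3⟩ := hD
    exact CL5.disjIntro ⟨L₁.map (Formula.map f), L₂.map (Formula.map f), F.map f, G.map f,
      by simp [Cirquent.map, h1], by simp [Cirquent.map, h2, Formula.map],
      by simp [Cirquent.map, h3]⟩ hC
  | conjIntro hD _ hC =>
    obtain ⟨L₁, L₂, F, G, h1, h2, h3, h4, h5, h6⟩ := hD
    exact CL5.conjIntro ⟨L₁.map (Formula.map f), L₂.map (Formula.map f), F.map f, G.map f,
      by simp [Cirquent.map, h1], by simpa [Cirquent.map] using h2,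
      by simpa [Cirquent.map] using h3, by simpa [Cirquent.map] using h4,
      by simp [Cirquent.map, h5, Formula.map], by simp [Cirquent.map, h6]⟩ hC

/-! ### Derived structural rules -/

namespace Cirquent

/-- All groups consist of positions in the pool. -/
def Bounded (p : List (Formula A)) (S : List (Finset ℕ)) : Prop :=
  ∀ Γ ∈ S, ∀ i ∈ Γ, i < p.length

/-- The pool `p` and the structure `S` form a cirquent that is provable in `CL5`. -/
def Provable (p : List (Formula A)) (S : List (Finset ℕ)) : Prop :=
  ∃ h : Bounded p S, CL5 ⟨p, S, h⟩

theorem Bounded.map_image {p q : List (Formula A)} {S : List (Finset ℕ)} {f : ℕ → ℕ}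
    (h : Bounded p S) (hf : ∀ i < p.length, f i < q.length) :
    Bounded q (S.map fun Γ => Γ.image f) := by
  intro Γ hΓ i hi
  obtain ⟨Δ, hΔ, rfl⟩ := List.mem_map.1 hΓ
  obtain ⟨j, hj, rfl⟩ := Finset.mem_image.1 hi
  exact hf j (h Δ hΔ j hj)

namespace Provable

variable {p q : List (Formula A)} {S T : List (Finset ℕ)}

theorem swap_pool {L₁ L₂ : List (Formula A)} {F G : Formula A}
    (h : Provable (L₁ ++ F :: G :: L₂) S) :
    Provable (L₁ ++ G :: F :: L₂)
      (S.map fun Γ => Γ.image (Equiv.swap L₁.length (L₁.length + 1))) := by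
  obtain ⟨hb, h⟩ := h
  refine ⟨hb.map_image fun i hi => ?_, CL5.oformulaExchange ⟨L₁, L₂, F, G, rfl, rfl, rfl⟩ h⟩
  have := getElem?_swap L₁ L₂ F G i
  rw [List.getElem?_eq_getElem hi] at this
  exact (List.getElem?_eq_some_iff.1 this).1

theorem append_pool (h : Provable p S) (q : List (Formula A)) : Provable (p ++ q) S := by
  induction q generalizing p with
  | nil => simpa using h
  | cons F q ih =>
    have : p ++ F :: q = p ++ [F] ++ q := by simp
    rw [this]
    refine ih ?_
    obtain ⟨hb, h⟩ := h
    refine ⟨fun Γ hΓ i hi => (hb Γ hΓ i hi).trans (by simp),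
      CL5.poolWeakening ⟨p, [], F, by simp, rfl, ?_⟩ h⟩
    refine (List.map_id S).symm.trans (List.map_congr_left fun Γ hΓ => ?_)
    refine Finset.image_id.symm.trans (Finset.image_congr fun i hi => ?_)
    exact (if_pos (hb Γ hΓ i hi)).symm

/-- Adjacent swaps generate all permutations. The prefix `R` absorbs the heads passed in the
induction; it plays the same role in the lemmas below. -/
theorem perm_str (hST : S.Perm T) {R : List (Finset ℕ)} (h : Provable p (R ++ S)) :
    Provable p (R ++ T) := by
  induction hST generalizing R with
  | nil => exact h
  | cons Γ _ ih => simpa using ih (R := R ++ [Γ]) (by simpa using h)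
  | swap Γ Δ S =>
    obtain ⟨hb, h⟩ := h
    refine ⟨fun E hE => hb E ?_,
      CL5.ogroupExchange (C := ⟨p, _, hb⟩) ⟨R, S, Δ, Γ, rfl, rfl, rfl⟩ h⟩
    simp only [List.mem_append, List.mem_cons] at hE ⊢
    tauto
  | trans _ _ ih ih' => exact ih' (ih h)

theorem insert_group {Γ : Finset ℕ} {i : ℕ} (hi : i < p.length) (h : Provable p (S ++ Γ :: T)) :
    Provable p (S ++ insert i Γ :: T) := by
  by_cases hiΓ : i ∈ Γ
  · rwa [Finset.insert_eq_of_mem hiΓ]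
  obtain ⟨hb, h⟩ := h
  refine ⟨fun E hE => ?_,
    CL5.ogroupWeakening (C := ⟨p, _, hb⟩) ⟨S, T, Γ, i, hi, hiΓ, rfl, rfl, rfl⟩ h⟩
  simp only [List.mem_append, List.mem_cons] at hE
  rcases hE with hE | rfl | hE
  · exact hb E (by simp [hE])
  · intro j hj
    rcases Finset.mem_insert.1 hj with rfl | hj
    · exact hi
    · exact hb Γ (by simp) j hj
  · exact hb E (by simp [hE])

theorem union_group {Γ E : Finset ℕ} (hE : ∀ i ∈ E, i < p.length)
    (h : Provable p (S ++ Γ :: T)) : Provable p (S ++ (E ∪ Γ) :: T) := by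
  induction E using Finset.induction_on with
  | empty => simpa using h
  | insert i E _ ih =>
    rw [Finset.insert_union]
    exact insert_group (hE i (by simp)) (ih fun j hj => hE j (by simp [hj]))

theorem mono_str (hST : List.Forall₂ (· ⊆ ·) S T) {R : List (Finset ℕ)} (hb : Bounded p T)
    (h : Provable p (R ++ S)) : Provable p (R ++ T) := by
  induction hST generalizing R with
  | nil => exact h
  | @cons Γ Δ S T hΓ _ ih =>
    have h' := union_group (E := Δ) (hb Δ (by simp)) h
    rw [Finset.union_eq_left.2 hΓ] at h'
    simpa using ih (R := R ++ [Δ]) (fun E hE => hb E (by simp [hE])) (by simpa using h')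

theorem map_of_map_dedup {L : Type*} [DecidableEq L] (f : L → Finset ℕ) (l : List L)
    {R : List (Finset ℕ)} (h : Provable p (R ++ l.dedup.map f)) : Provable p (R ++ l.map f) := by
  induction l generalizing R with
  | nil => exact h
  | cons a l ih =>
    by_cases ha : a ∈ l
    · rw [List.dedup_cons_of_mem ha] at h
      -- Duplication yields adjacent copies only, so an existing copy of `f a` is first moved to the
      -- front, doubled, and one copy moved back.
      have hperm := (List.perm_cons_erase ha).map f
      obtain ⟨hb, h⟩ := perm_str hperm (ih h)
      have : Provable p (R ++ f a :: f a :: (l.erase a).map f) := by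
        refine ⟨fun E hE => hb E ?_,
          CL5.downwardDuplication (C := ⟨p, _, hb⟩) ⟨R, (l.erase a).map f, f a, rfl, rfl, rfl⟩ h⟩
        simp only [List.map_cons, List.mem_append, List.mem_cons] at hE ⊢
        tauto
      exact perm_str (hperm.symm.cons (f a)) this
    · rw [List.dedup_cons_of_notMem ha] at h
      simpa using ih (R := R ++ [f a]) (by simpa using h)

end Provable

/-! ### Tautological cirquents of literals -/

open Classical in
/-- The group of all positions of the literals `P` and `¬P`. -/
noncomputable def pairPositions (p : List (Formula A)) (P : A) : Finset ℕ :=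
  {i ∈ Finset.range p.length | p[i]? = some (.atom P) ∨ p[i]? = some (.negAtom P)}

theorem mem_pairPositions {p : List (Formula A)} {P : A} {i : ℕ} :
    i ∈ pairPositions p P ↔ p[i]? = some (.atom P) ∨ p[i]? = some (.negAtom P) := by
  simp only [pairPositions, Finset.mem_filter, Finset.mem_range, and_iff_right_iff_imp]
  rintro (h | h) <;> exact (List.getElem?_eq_some_iff.1 h).1

theorem bounded_pairPositions (p : List (Formula A)) (l : List A) :
    Bounded p (l.map (pairPositions p)) := by
  intro Γ hΓ i hi
  obtain ⟨P, -, rfl⟩ := List.mem_map.1 hΓ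
  rcases mem_pairPositions.1 hi with h | h <;> exact (List.getElem?_eq_some_iff.1 h).1

theorem image_swap_pairPositions (L₁ L₂ : List (Formula A)) (F G : Formula A) (P : A) :
    (pairPositions (L₁ ++ F :: G :: L₂) P).image (Equiv.swap L₁.length (L₁.length + 1)) =
      pairPositions (L₁ ++ G :: F :: L₂) P := by
  ext i
  simp only [Finset.mem_image, mem_pairPositions]
  constructor
  · rintro ⟨j, hj, rfl⟩
    rwa [getElem?_swap]
  · intro h
    refine ⟨Equiv.swap L₁.length (L₁.length + 1) i, ?_, Equiv.swap_apply_self _ _ _⟩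
    rwa [getElem?_swap]

/-- The groups are defined by pool contents rather than positions, so they follow each exchange
automatically and no permutation of indices has to be tracked. -/
theorem Provable.perm_pool {p q : List (Formula A)} (hpq : p.Perm q) {l : List A}
    {r : List (Formula A)} (h : Provable (r ++ p) (l.map (pairPositions (r ++ p)))) :
    Provable (r ++ q) (l.map (pairPositions (r ++ q))) := by
  induction hpq generalizing r with
  | nil => exact h
  | cons F _ ih => simpa using ih (r := r ++ [F]) (by simpa using h)
  | swap F G p =>
    have := h.swap_pool
    rw [List.map_map] at this
    refine cast (congrArg _ (List.map_congr_left fun P _ => ?_)) this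
    exact image_swap_pairPositions _ _ _ _ P
  | trans _ _ ih ih' => exact ih' (ih h)

/-- Mix of the atomic identity axioms. An atom repeated in `l` makes the groups larger, which ogroup
weakening supplies. -/
theorem provable_pairs (l : List A) :
    Provable (l.flatMap fun P => [.negAtom P, .atom P])
      (l.map (pairPositions (l.flatMap fun P => [.negAtom P, .atom P]))) := by
  induction l with
  | nil => exact ⟨by simp [Bounded], CL5.empty⟩
  | cons P l ih =>
    obtain ⟨hb, h⟩ := ih
    generalize hp : l.flatMap (fun P => [Formula.negAtom P, Formula.atom P]) = p at hb h
    have key : Provable ([.negAtom P, .atom P] ++ p) ([{0, 1}] ++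
        (l.map (pairPositions p)).map fun Γ => Γ.image fun i => 2 + i) := by
      refine ⟨fun Γ hΓ => ?_, CL5.mix ⟨rfl, rfl⟩ (CL5.identity (.atom P)) h⟩
      rcases List.mem_append.1 hΓ with hΓ | hΓ
      · simp only [List.mem_singleton] at hΓ
        subst hΓ
        intro i hi
        simp only [Finset.mem_insert, Finset.mem_singleton] at hi
        rcases hi with rfl | rfl <;> simp
      · refine hb.map_image (fun i hi => ?_) Γ hΓ
        simp only [List.length_append, List.length_cons, List.length_nil]
        omega
    rw [List.flatMap_cons, hp]
    refine key.mono_str (R := []) ?_ (bounded_pairPositions _ (P :: l))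
    refine List.Forall₂.cons ?_ ?_
    · intro i hi
      simp only [Finset.mem_insert, Finset.mem_singleton] at hi
      rw [mem_pairPositions]
      rcases hi with rfl | rfl <;> simp
    · change List.Forall₂ _ (List.map _ (List.map _ l)) _
      rw [List.map_map, List.forall₂_map_left_iff, List.forall₂_map_right_iff, List.forall₂_same]
      intro Q _ i hi
      obtain ⟨j, hj, rfl⟩ := Finset.mem_image.1 hi
      rw [mem_pairPositions] at hj ⊢
      rw [add_comm]
      exact hj

theorem ports_ne_nil (F : Formula A) : F.ports ≠ [] := by
  induction F <;> simp_all [Formula.ports]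

theorem nodup_of_nodup_ports {p : List (Formula A)} (h : (p.flatMap Formula.ports).Nodup) :
    p.Nodup := by
  refine (List.nodup_flatMap.1 h).2.imp fun {F G} hFG => ?_
  rintro rfl
  obtain ⟨x, hx⟩ := List.exists_mem_of_ne_nil _ (ports_ne_nil F)
  exact hFG hx hx

/-- The number of connectives of a formula. -/
def _root_.CirquentCalculus.Formula.connectives : Formula A → ℕ
  | .atom _ => 0
  | .negAtom _ => 0
  | .conj F G => F.connectives + G.connectives + 1
  | .disj F G => F.connectives + G.connectives + 1

theorem exists_complementary {p : List (Formula A)} {S : List (Finset ℕ)}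
    (hp : ∀ F ∈ p, F.connectives = 0) (hS : ∀ v, Sat v p S) {Γ : Finset ℕ} (hΓ : Γ ∈ S) :
    ∃ P, (∃ i ∈ Γ, p[i]? = some (.atom P)) ∧ ∃ i ∈ Γ, p[i]? = some (.negAtom P) := by
  -- This valuation falsifies all negative literals of `Γ`, so the true oformula is an atom, and its
  -- being true says that its negation is in `Γ` too.
  obtain ⟨i, hi, F, hF, hv⟩ := hS (fun P => ∃ i ∈ Γ, p[i]? = some (.negAtom P)) Γ hΓ
  have hF0 := hp F (List.mem_of_getElem? hF)
  cases F with
  | atom P => exact ⟨P, ⟨i, hi, hF⟩, hv⟩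
  | negAtom P => exact absurd ⟨i, hi, hF⟩ hv
  | conj F G => simp [Formula.connectives] at hF0
  | disj F G => simp [Formula.connectives] at hF0

/-- Pick a complementary pair in each group. The pairs for the distinct chosen atoms are provable by
mix; pool weakening and exchange give the pool, duplication the multiplicity of groups, and ogroup
weakening the remaining arcs. -/
theorem provable_of_literals [Nonempty A] {p : List (Formula A)} {S : List (Finset ℕ)}
    (hb : Bounded p S) (hp : ∀ F ∈ p, F.connectives = 0)
    (hnd : p.Nodup) (hS : ∀ v, Sat v p S) : Provable p S := by
  classical
  choose! P hP using fun Γ (hΓ : Γ ∈ S) => exists_complementary hp hS hΓ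
  let l := (S.map P).dedup
  -- Distinct atoms give distinct literals, all present in `p`; the rest of `p` is the `q` below.
  have hsub : (l.flatMap fun P => [Formula.negAtom P, Formula.atom P]).Subperm p := by
    refine List.subperm_of_subset (List.nodup_flatMap.2 ⟨fun _ _ => by simp, ?_⟩) fun F hF => ?_
    · refine (List.nodup_dedup _).imp fun {P Q} hPQ => ?_
      simp only [Function.onFun, List.Disjoint]
      rintro F hF hF'
      simp only [List.mem_cons, List.not_mem_nil, or_false] at hF hF'
      rcases hF with rfl | rfl <;> simp_all
    · obtain ⟨Q, hQ, hF⟩ := List.mem_flatMap.1 hF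
      obtain ⟨Γ, hΓ, rfl⟩ := List.mem_map.1 (List.mem_dedup.1 hQ)
      obtain ⟨⟨i, -, hi⟩, j, -, hj⟩ := hP Γ hΓ
      simp only [List.mem_cons, List.not_mem_nil, or_false] at hF
      rcases hF with rfl | rfl
      · exact List.mem_of_getElem? hj
      · exact List.mem_of_getElem? hi
  obtain ⟨l', hl', hsub⟩ := hsub
  obtain ⟨q, hq⟩ := hsub.exists_perm_append
  replace hq := hq.trans (hl'.append_right q)
  have h1 := (provable_pairs l).append_pool q
  have h2 := h1.mono_str (R := []) (T := l.map (pairPositions _)) (by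
    rw [List.forall₂_map_left_iff, List.forall₂_map_right_iff, List.forall₂_same]
    intro Q _ i hi
    rw [mem_pairPositions] at hi ⊢
    have hlt : i < (l.flatMap fun P => [Formula.negAtom P, Formula.atom P]).length := by
      rcases hi with h | h <;> exact (List.getElem?_eq_some_iff.1 h).1
    rwa [List.getElem?_append_left hlt]) (bounded_pairPositions _ _)
  have h3 := Provable.perm_pool (r := []) hq.symm h2
  have h4 := Provable.map_of_map_dedup (R := []) _ _ h3
  refine h4.mono_str (R := []) ?_ hb
  rw [List.nil_append, List.map_map, List.forall₂_map_left_iff, List.forall₂_same]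
  intro Γ hΓ i hi
  obtain ⟨⟨j, hj, hj'⟩, k, hk, hk'⟩ := hP Γ hΓ
  -- Since no literal repeats in `p`, the group of the chosen atom consists of just the two
  -- positions found in `Γ`, hence is a subset of `Γ`.
  have hinj : ∀ {i j : ℕ} {F : Formula A}, p[i]? = some F → p[j]? = some F → i = j := by
    intro i j F h h'
    exact (List.getElem?_inj (List.getElem?_eq_some_iff.1 h).1 hnd).1 (h.trans h'.symm)
  rcases mem_pairPositions.1 hi with h | h
  · exact hinj h hj' ▸ hj
  · exact hinj h hk' ▸ hk

/-! ### Inverting the introduction rules -/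

/-- The preimage of a group under the merging of the positions `n` and `n + 1`, in a pool of
length `m`. -/
def splitPositions (n m : ℕ) (Γ : Finset ℕ) : Finset ℕ :=
  {i ∈ Finset.range m | (if i ≤ n then i else i - 1) ∈ Γ}

theorem mem_splitPositions {n m i : ℕ} {Γ : Finset ℕ} :
    i ∈ splitPositions n m Γ ↔ i < m ∧ (if i ≤ n then i else i - 1) ∈ Γ := by
  simp [splitPositions]

theorem mergePositions_splitPositions {n m : ℕ} {Γ : Finset ℕ}
    (hΓ : ∀ i ∈ Γ, i < m) : mergePositions n (splitPositions n (m + 1) Γ) = Γ := by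
  ext i
  simp only [mergePositions, Finset.mem_image, mem_splitPositions]
  constructor
  · rintro ⟨j, ⟨-, hj⟩, rfl⟩
    exact hj
  · intro hi
    have := hΓ i hi
    rcases le_or_gt i n with h | h
    · have e : (if i ≤ n then i else i - 1) = i := if_pos h
      exact ⟨i, ⟨by omega, by rwa [e]⟩, e⟩
    · have e : (if i + 1 ≤ n then i + 1 else i + 1 - 1) = i := if_neg (by omega)
      exact ⟨i + 1, ⟨by omega, by rwa [e]⟩, e⟩

theorem map_mergePositions_splitPositions {n m : ℕ} {S : List (Finset ℕ)}
    (hS : ∀ Γ ∈ S, ∀ i ∈ Γ, i < m) :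
    (S.map (splitPositions n (m + 1))).map (mergePositions n) = S := by
  rw [List.map_map]
  exact (List.map_congr_left fun Γ hΓ => mergePositions_splitPositions (hS Γ hΓ)).trans
    (List.map_id S)

/-- Split every group containing the position `n` into two groups, the first of which contains
`n` but not `n + 1`, and the second of which contains `n + 1` but not `n`. -/
def splitGroups (n m : ℕ) : List (Finset ℕ) → List (Finset ℕ)
  | [] => []
  | Γ :: S =>
    if n ∈ Γ then
      (splitPositions n m Γ).erase (n + 1) :: (splitPositions n m Γ).erase n :: splitGroups n m S
    else splitPositions n m Γ :: splitGroups n m S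

theorem mergeGroups_cons_of_notMem {n : ℕ} {Γ : Finset ℕ} (h : n ∉ Γ) (S : List (Finset ℕ)) :
    mergeGroups n (Γ :: S) = Γ :: mergeGroups n S := by
  cases S with
  | nil => rfl
  | cons Δ S => rw [mergeGroups, if_neg h]

section SplitGroups

variable {n m : ℕ} {Γ : Finset ℕ}

theorem left_mem_splitPositions (hn : n < m) : n ∈ splitPositions n m Γ ↔ n ∈ Γ := by
  simp [mem_splitPositions, hn]

theorem right_mem_splitPositions (hn : n + 1 < m) : n + 1 ∈ splitPositions n m Γ ↔ n ∈ Γ := by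
  simp [mem_splitPositions, hn]

theorem mergeGroups_splitGroups (hn : n < m) (S : List (Finset ℕ)) :
    mergeGroups n (splitGroups n m S) = S.map (splitPositions n m) := by
  induction S with
  | nil => rfl
  | cons Γ S ih =>
    by_cases h : n ∈ Γ
    · have h' : n ∈ (splitPositions n m Γ).erase (n + 1) := by
        simp [left_mem_splitPositions hn, h]
      rw [splitGroups, if_pos h, mergeGroups, if_pos h', ih, List.map_cons]
      congr 1
      ext i
      simp only [Finset.mem_union, Finset.mem_erase]
      by_cases e : i = n
      · subst e; simp
      · simp [e]
    · rw [splitGroups, if_neg h, mergeGroups_cons_of_notMem, ih, List.map_cons]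
      rwa [left_mem_splitPositions hn]

theorem mem_splitGroups {S : List (Finset ℕ)} {Δ : Finset ℕ} (h : Δ ∈ splitGroups n m S) :
    ∃ Γ ∈ S, (n ∉ Γ ∧ Δ = splitPositions n m Γ) ∨
      (n ∈ Γ ∧ Δ = (splitPositions n m Γ).erase (n + 1)) ∨
      (n ∈ Γ ∧ Δ = (splitPositions n m Γ).erase n) := by
  induction S with
  | nil => simp [splitGroups] at h
  | cons Γ S ih =>
    by_cases hn : n ∈ Γ
    · rw [splitGroups, if_pos hn, List.mem_cons, List.mem_cons] at h
      rcases h with h | h | h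
      · exact ⟨Γ, by simp, by tauto⟩
      · exact ⟨Γ, by simp, by tauto⟩
      · obtain ⟨E, hE, h⟩ := ih h
        exact ⟨E, by simp [hE], h⟩
    · rw [splitGroups, if_neg hn, List.mem_cons] at h
      rcases h with h | h
      · exact ⟨Γ, by simp, by tauto⟩
      · obtain ⟨E, hE, h⟩ := ih h
        exact ⟨E, by simp [hE], h⟩

theorem not_both_mem_splitGroups (hn : n + 1 < m) {S : List (Finset ℕ)} {Δ : Finset ℕ}
    (h : Δ ∈ splitGroups n m S) : ¬ (n ∈ Δ ∧ n + 1 ∈ Δ) := by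
  obtain ⟨Γ, -, ⟨hΓ, rfl⟩ | ⟨-, rfl⟩ | ⟨-, rfl⟩⟩ := mem_splitGroups h
  · rw [left_mem_splitPositions (by omega)]
    tauto
  · simp
  · simp

theorem splitGroups_next (hn : n + 1 < m) (S : List (Finset ℕ)) (j : ℕ) (Δ : Finset ℕ)
    (hj : (splitGroups n m S)[j]? = some Δ) (hΔ : n ∈ Δ) :
    ∃ E : Finset ℕ, (splitGroups n m S)[j + 1]? = some E ∧ n + 1 ∈ E := by
  induction S generalizing j with
  | nil => simp [splitGroups] at hj
  | cons Γ S ih =>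
    by_cases h : n ∈ Γ
    · rw [splitGroups, if_pos h] at hj ⊢
      match j with
      | 0 => exact ⟨_, rfl, by simp [right_mem_splitPositions hn, h]⟩
      | 1 =>
        simp only [List.getElem?_cons_succ, List.getElem?_cons_zero, Option.some.injEq] at hj
        subst hj
        simp at hΔ
      | j + 2 => exact ih j hj
    · rw [splitGroups, if_neg h] at hj ⊢
      match j with
      | 0 =>
        simp only [List.getElem?_cons_zero, Option.some.injEq] at hj
        subst hj
        exact absurd ((left_mem_splitPositions (by omega)).1 hΔ) h
      | j + 1 => exact ih j hj

theorem splitGroups_prev (hn : n + 1 < m) (S : List (Finset ℕ)) (j : ℕ) (Δ : Finset ℕ)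
    (hj : (splitGroups n m S)[j]? = some Δ) (hΔ : n + 1 ∈ Δ) :
    ∃ (k : ℕ) (E : Finset ℕ), k + 1 = j ∧ (splitGroups n m S)[k]? = some E ∧ n ∈ E := by
  induction S generalizing j with
  | nil => simp [splitGroups] at hj
  | cons Γ S ih =>
    by_cases h : n ∈ Γ
    · rw [splitGroups, if_pos h] at hj ⊢
      match j with
      | 0 =>
        simp only [List.getElem?_cons_zero, Option.some.injEq] at hj
        subst hj
        simp at hΔ
      | 1 => exact ⟨0, _, rfl, rfl, by simp [left_mem_splitPositions (Nat.lt_of_succ_lt hn), h]⟩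
      | j + 2 =>
        obtain ⟨k, E, hk, hE⟩ := ih j hj
        exact ⟨k + 2, E, by omega, hE⟩
    · rw [splitGroups, if_neg h] at hj ⊢
      match j with
      | 0 =>
        simp only [List.getElem?_cons_zero, Option.some.injEq] at hj
        subst hj
        exact absurd ((right_mem_splitPositions hn).1 hΔ) h
      | j + 1 =>
        obtain ⟨k, E, hk, hE⟩ := ih j hj
        exact ⟨k + 1, E, by omega, hE⟩

end SplitGroups

theorem exists_holdsAt_split {v : A → Prop} {L₁ L₂ : List (Formula A)} {F G H : Formula A} {i : ℕ}
    (h : HoldsAt v (L₁ ++ H :: L₂) i) (hi : i ≠ L₁.length) :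
    ∃ j, (if j ≤ L₁.length then j else j - 1) = i ∧ j ≠ L₁.length ∧ j ≠ L₁.length + 1 ∧
      HoldsAt v (L₁ ++ F :: G :: L₂) j := by
  rcases lt_or_gt_of_ne hi with hlt | hlt
  · refine ⟨i, if_pos hlt.le, hi, by omega, ?_⟩
    rw [holdsAt_append_of_lt hlt] at h ⊢
    exact h
  · refine ⟨i + 1, if_neg (by omega), by omega, by omega, ?_⟩
    obtain ⟨k, rfl⟩ := Nat.exists_eq_add_of_lt hlt
    rw [add_assoc, holdsAt_append_add, holdsAt_cons_succ] at h
    rw [add_assoc, add_assoc, holdsAt_append_add, ← add_assoc, holdsAt_cons_succ, holdsAt_cons_succ]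
    exact h

section Decomposition

variable {v : A → Prop} {L₁ L₂ : List (Formula A)} {F G : Formula A} {S : List (Finset ℕ)}

theorem holdsAt_left (h : F.Holds v) : HoldsAt v (L₁ ++ F :: G :: L₂) L₁.length := by
  rwa [holdsAt_append_length, holdsAt_cons_zero]

theorem holdsAt_right (h : G.Holds v) : HoldsAt v (L₁ ++ F :: G :: L₂) (L₁.length + 1) := by
  rwa [holdsAt_append_add, holdsAt_cons_succ, holdsAt_cons_zero]

/-- Soundness of `∨`-introduction read upwards: a group with a true disjunction now contains both
disjuncts, one of them true. -/
theorem Sat.disj_split (h : Sat v (L₁ ++ .disj F G :: L₂) S) :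
    Sat v (L₁ ++ F :: G :: L₂)
      (S.map (splitPositions L₁.length ((L₁ ++ .disj F G :: L₂).length + 1))) := by
  intro Δ hΔ
  obtain ⟨Γ, hΓ, rfl⟩ := List.mem_map.1 hΔ
  obtain ⟨i, hi, h⟩ := h Γ hΓ
  have hlen : L₁.length + 1 < (L₁ ++ .disj F G :: L₂).length + 1 := by simp
  by_cases e : i = L₁.length
  · subst e
    rcases h.holds_left rfl with h | h
    · exact ⟨_, (left_mem_splitPositions (by omega)).2 hi, holdsAt_left h⟩
    · exact ⟨_, (right_mem_splitPositions hlen).2 hi, holdsAt_right h⟩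
  · obtain ⟨j, rfl, -, -, hj⟩ := exists_holdsAt_split (F := F) (G := G) h e
    have := hj.lt_length
    refine ⟨j, mem_splitPositions.2 ⟨?_, hi⟩, hj⟩
    simpa [add_assoc] using this

/-- A true conjunction serves both halves of a split group, one conjunct each; any other true
oformula lies in both halves. -/
theorem Sat.conj_split (h : Sat v (L₁ ++ .conj F G :: L₂) S) :
    Sat v (L₁ ++ F :: G :: L₂)
      (splitGroups L₁.length ((L₁ ++ .conj F G :: L₂).length + 1) S) := by
  intro Δ hΔ
  obtain ⟨Γ, hΓ, hΔ⟩ := mem_splitGroups hΔ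
  obtain ⟨i, hi, h⟩ := h Γ hΓ
  have hlen : L₁.length + 1 < (L₁ ++ .conj F G :: L₂).length + 1 := by simp
  by_cases e : i = L₁.length
  · subst e
    obtain ⟨hF, hG⟩ := h.holds_left rfl
    rcases hΔ with ⟨hn, -⟩ | ⟨-, rfl⟩ | ⟨-, rfl⟩
    · exact absurd hi hn
    · exact ⟨_, by simpa using (left_mem_splitPositions (by omega)).2 hi, holdsAt_left hF⟩
    · exact ⟨_, by simpa using (right_mem_splitPositions hlen).2 hi, holdsAt_right hG⟩
  · obtain ⟨j, rfl, hj1, hj2, hj⟩ := exists_holdsAt_split (F := F) (G := G) h e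
    have := hj.lt_length
    have hjΓ : j ∈ splitPositions L₁.length ((L₁ ++ .conj F G :: L₂).length + 1) Γ := by
      refine mem_splitPositions.2 ⟨?_, hi⟩
      simpa [add_assoc] using this
    refine ⟨j, ?_, hj⟩
    rcases hΔ with ⟨-, rfl⟩ | ⟨-, rfl⟩ | ⟨-, rfl⟩
    · exact hjΓ
    · exact Finset.mem_erase.2 ⟨hj2, hjΓ⟩
    · exact Finset.mem_erase.2 ⟨hj1, hjΓ⟩

end Decomposition

/-! ### Completeness and conclusion -/

/-- Induction on the number of connectives in the pool. Splitting a compound oformula removes one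
connective and leaves the sequence of literals unchanged, so the cirquent stays binary. -/
theorem provable_of_sat [Nonempty A] {p : List (Formula A)} {S : List (Finset ℕ)}
    (hb : Bounded p S) (hnd : (p.flatMap Formula.ports).Nodup) (hS : ∀ v, Sat v p S) :
    Provable p S := by
  induction hk : (p.map Formula.connectives).sum using Nat.strong_induction_on
    generalizing p S with
  | _ k ih =>
  by_cases hp : ∀ F ∈ p, F.connectives = 0
  · exact provable_of_literals hb hp (nodup_of_nodup_ports hnd) hS
  push Not at hp
  obtain ⟨H, hH, hH0⟩ := hp
  obtain ⟨L₁, L₂, rfl⟩ := List.append_of_mem hH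
  cases H with
  | atom P => simp [Formula.connectives] at hH0
  | negAtom P => simp [Formula.connectives] at hH0
  | disj F G =>
    have hb' : Bounded (L₁ ++ F :: G :: L₂)
        (S.map (splitPositions L₁.length ((L₁ ++ .disj F G :: L₂).length + 1))) := by
      intro Δ hΔ i hi
      obtain ⟨Γ, -, rfl⟩ := List.mem_map.1 hΔ
      simpa [add_assoc] using (mem_splitPositions.1 hi).1
    obtain ⟨_, h⟩ := ih _ (by simp [← hk, Formula.connectives]; omega) hb'
      (by simpa [Formula.ports] using hnd) (fun v => (hS v).disj_split) rfl
    exact ⟨hb, CL5.disjIntro (C := ⟨_, _, hb'⟩)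
      ⟨L₁, L₂, F, G, rfl, rfl, (map_mergePositions_splitPositions hb).symm⟩ h⟩
  | conj F G =>
    have hlen : L₁.length + 1 < (L₁ ++ .conj F G :: L₂).length + 1 := by simp
    have hb' : Bounded (L₁ ++ F :: G :: L₂)
        (splitGroups L₁.length ((L₁ ++ .conj F G :: L₂).length + 1) S) := by
      intro Δ hΔ i hi
      obtain ⟨Γ, -, hΔ⟩ := mem_splitGroups hΔ
      have : i ∈ splitPositions L₁.length ((L₁ ++ .conj F G :: L₂).length + 1) Γ := by
        rcases hΔ with ⟨-, rfl⟩ | ⟨-, rfl⟩ | ⟨-, rfl⟩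
        · exact hi
        · exact Finset.mem_of_mem_erase hi
        · exact Finset.mem_of_mem_erase hi
      simpa [add_assoc] using (mem_splitPositions.1 this).1
    obtain ⟨_, h⟩ := ih _ (by simp [← hk, Formula.connectives]; omega) hb'
      (by simpa [Formula.ports] using hnd) (fun v => (hS v).conj_split) rfl
    refine ⟨hb, CL5.conjIntro (C := ⟨_, _, hb'⟩) ⟨L₁, L₂, F, G, rfl,
      fun Γ hΓ => not_both_mem_splitGroups hlen hΓ,
      splitGroups_next hlen S, splitGroups_prev hlen S, rfl, ?_⟩ h⟩
    rw [mergeGroups_splitGroups (by omega), map_mergePositions_splitPositions hb]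

end Cirquent

theorem cl5_iff_isBinaryInstance [Nonempty A] {C : Cirquent A} :
    CL5 C ↔ Cirquent.IsBinaryInstance C.pool C.str := by
  refine ⟨CL5.isBinaryInstance, ?_⟩
  rintro ⟨p, hp, hnd, hsat⟩
  obtain ⟨hb, h⟩ := Cirquent.provable_of_sat (p := p) (S := C.str)
    (fun Γ hΓ i hi => by simpa [← hp] using C.lt_of_mem Γ hΓ i hi) hnd hsat
  rw [← Cirquent.eq_of_pool_str (C := Cirquent.map Prod.fst ⟨p, C.str, hb⟩) hp rfl]
  -- Forgetting the labels maps the proof of the binary tautology to a proof of `C`.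
  exact h.map Prod.fst

end CirquentCalculus

theorem theorem8p13 {Atom : Type*} [Infinite Atom] :
    (∀ C : CirquentCalculus.Cirquent Atom,
      CirquentCalculus.CL5 C ↔ C.resource.Trivial) ∧
    (∀ F : CirquentCalculus.Formula Atom,
      CirquentCalculus.CL5 (CirquentCalculus.Cirquent.singleton F) ↔ F.resource.Trivial) := by
  have key : ∀ C : CirquentCalculus.Cirquent Atom,
      CirquentCalculus.CL5 C ↔ C.resource.Trivial := fun C =>
    CirquentCalculus.cl5_iff_isBinaryInstance.trans
      ⟨CirquentCalculus.Cirquent.trivial_of_isBinaryInstance,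
        CirquentCalculus.Cirquent.isBinaryInstance_of_trivial⟩
  exact ⟨key, fun F => (key _).trans (CirquentCalculus.Cirquent.trivial_singleton_iff F)⟩
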